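/- For $a>-1$, $b\in\mathbb{C}$ let $W_{a,b}(z)=\sum_{n\ge 0}\frac{z^n}{n!\,\Gamma(an+b)}$ be the Wright function, and for $a>0$ let $E_{a,b}(z)=\sum_{n\ge 0}\frac{z^n}{\Gamma(an+b)}$ be the Mittag-Leffler function, $E_a=E_{a,1}$ (with $1/\Gamma=0$ at the poles of $\Gamma$). For $0<\gamma<1$ put $M_\gamma(y)=W_{-\gamma,1-\gamma}(-y)$ and $N_\gamma(y)=W_{-\gamma,2-\gamma}(-y)$. Write $\int_{(c)}$ for the integral along the vertical line $\operatorname{Re}s=c$, directed upwards. (1) Let $0<\beta<2$. For all $z>0$ and $0<c<1$, $$E_\beta(-z)=\frac{1}{2\pi i}\int_{(c)}\frac{\Gamma(s)\Gamma(1-s)}{\Gamma(1-\beta s)}\,z^{-s}\,ds,\qquad E_{\beta,2}(-z)=\frac{1}{2\pi i}\int_{(c)}\frac{\Gamma(s)\Gamma(1-s)}{\Gamma(2-\beta s)}\,z^{-s}\,ds,$$ and for $0<\operatorname{Re}s<1$, $$\int_0^\infty E_\beta(-x)\,x^{s-1}\,dx=\frac{\Gamma(s)\Gamma(1-s)}{\Gamma(1-\beta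 s)},\qquad \int_0^\infty E_{\beta,2}(-x)\,x^{s-1}\,dx=\frac{\Gamma(s)\Gamma(1-s)}{\Gamma(2-\beta s)};$$ all these integrals converge absolutely. (2) For $\beta=2$ the four formulas of (1) hold with improper integrals (contour integrals as limits of $\int_{c-iS}^{c+iT}$ as $S,T\to\infty$ independently; Mellin integrals as limits of $\int_0^R$ as $R\to\infty$) in the following ranges: the contour integral for $E_2(-z)$, $z>0$, for $0<c<\tfrac14$; the one for $E_{2,2}(-z)$, $z>0$, for $0<c<\tfrac34$; the Mellin integral of $E_2(-x)$ for $0<\operatorname{Re}s<\tfrac12$; the one of $E_{2,2}(-x)$ for $0<\operatorname{Re}s<1$. (3) Let $0<\gamma<1$. For all $y>0$ and $c>0$, $$M_\gamma(y)=\frac{1}{2\pi i}\int_{(c)}\frac{\Gamma(s)}{\Gamma(1+\gamma(s-1))}\,y^{-s}\,ds,\qquad N_\gamma(y)=\frac{1}{2\pi i}\int_{(c)}\frac{\Gamma(s)}{\Gamma(2+\gamma(s-1))}\,y^{-s}\,ds,$$ and for $\operatorname{Re}s>0$, $$\int_0^\infty M_\gamma(y)\,y^{s-1}\,dy=\frac{\Gamma(s)}{\Gamma(1+\gamma(s-1))},\qquad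 \int_0^\infty N_\gamma(y)\,y^{s-1}\,dy=\frac{\Gamma(s)}{\Gamma(2+\gamma(s-1))};$$ all these integrals converge absolutely. -/

import Mathlib

/-- The two-parameter Mittag-Leffler function `E_{a,b}(z) = ∑ zⁿ / Γ(a n + b)`
(with `1 / Γ = 0` at the poles of `Γ`); `E_a = E_{a,1}`. -/
noncomputable def mittagLeffler (a : ℝ) (b z : ℂ) : ℂ :=
  ∑' n : ℕ, z ^ n / Complex.Gamma ((n : ℂ) * (a : ℂ) + b)

/-- The Wright function `W_{a,b}(z) = ∑ zⁿ / (n! Γ(a n + b))`, `a > -1`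
(with `1 / Γ = 0` at the poles of `Γ`). -/
noncomputable def wright (a : ℝ) (b z : ℂ) : ℂ :=
  ∑' n : ℕ, z ^ n / ((n.factorial : ℂ) * Complex.Gamma ((n : ℂ) * (a : ℂ) + b))

/-- `M_γ(z) = W_{-γ,1-γ}(-z)`. -/
noncomputable def wrightM (γ : ℝ) (z : ℂ) : ℂ := wright (-γ) (1 - (γ : ℂ)) (-z)

/-- `N_γ(z) = W_{-γ,2-γ}(-z)`. -/
noncomputable def wrightN (γ : ℝ) (z : ℂ) : ℂ := wright (-γ) (2 - (γ : ℂ)) (-z)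

/-- `w = (1 / 2πi) ∫ G(s) ds` along the upward vertical line `Re s = c`, where the integral
is absolutely convergent. -/
def HasBromwichIntegral (c : ℝ) (G : ℂ → ℂ) (w : ℂ) : Prop :=
  MeasureTheory.Integrable (fun t : ℝ => G ((c : ℂ) + (t : ℂ) * Complex.I)) ∧
    w = 1 / (2 * (Real.pi : ℂ) * Complex.I) *
      ∫ t : ℝ, G ((c : ℂ) + (t : ℂ) * Complex.I) * Complex.I

/-- `w = (1 / 2πi) ∫ G(s) ds` along the upward vertical line `Re s = c`, where the integral is
an improper one: the two ends of the line are approached independently of each other. -/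
def HasImproperBromwichIntegral (c : ℝ) (G : ℂ → ℂ) (w : ℂ) : Prop :=
  Filter.Tendsto
    (fun p : ℝ × ℝ => 1 / (2 * (Real.pi : ℂ) * Complex.I) *
      ∫ t in (-p.1)..p.2, G ((c : ℂ) + (t : ℂ) * Complex.I) * Complex.I)
    (Filter.atTop ×ˢ Filter.atTop) (nhds w)

/-- `∫₀^∞ f(x) x^{s-1} dx = m`, as an improper integral at infinity; near `0` the integrand
is absolutely integrable. -/
def HasImproperMellin (f : ℝ → ℂ) (s m : ℂ) : Prop :=
  (∀ R : ℝ, 0 < R →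
    IntervalIntegrable (fun x : ℝ => (x : ℂ) ^ (s - 1) * f x) MeasureTheory.volume 0 R) ∧
  Filter.Tendsto (fun R : ℝ => ∫ x in (0 : ℝ)..R, (x : ℂ) ^ (s - 1) * f x)
    Filter.atTop (nhds m)

/-! Each contour integrand is `π / sin (π s)` times an entire function `H`: `z^{-s} / Γ(b - β s)` in
the Mittag-Leffler case, `y^{-s} / (Γ(1 - s) Γ(b + γ (s - 1)))` in the Wright case. Its residue at
`-n` is `(-1)^n H(-n)`, the `n`-th term of the power series, so moving the line of integration to
`-∞` sums the series (`LeftShiftBounds.tendsto_vertInt`).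

The shift needs `H` to grow more slowly than `cosh (π t)`. As `1 / Γ(x + iy)` has exponential rate
`π/2` in `|y|`, the rate of `H` is essentially `π β / 2`, respectively `π (1 + γ) / 2`, below `π`
for `β < 2` and `γ < 1`. For `β = 2` the exponentials cancel and only a power of `|t|` is left,
which tends to zero when `b - 2c > 1/2`; hence the ranges `1/4` and `3/4`. All bounds on `1 / Γ`
come from the product for `(Γ(x) / |Γ(x + iy)|)²` instead of Stirling's formula.

A function given by absolutely convergent inverse Mellin integrals on every line of an open strip is
`O(x^{-c})` for each `c` in it, so Fourier inversion yields its Mellin transform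
(`hasMellin_of_hasBromwichIntegral`). For `β = 2` this covers `E_{2,4}` on the whole strip `0 < Re s
< 1`; repeated integration by parts (`HasImproperMellin.of_hasDerivAt`) lowers the index from 4 to
3, 2 and 1. -/

open Filter Topology
open scoped FourierTransform

/-! ### Bounds for `1 / Γ` from Euler's product -/

/-- The square of `Γ(x) / |Γ(x + iy)|`. -/
noncomputable def gammaRatioSq (x y : ℝ) : ℝ :=
  (‖Complex.Gamma x‖ / ‖Complex.Gamma (x + y * Complex.I)‖) ^ 2

/-- In Euler's limit formula the factors `n^x` and `n!` have the same modulus at `x` and at `x +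
iy`, so the quotient of moduli leaves only the linear factors. -/
lemma tendsto_prod_gammaRatioSq {x : ℝ} (hx : 0 < x) (y : ℝ) :
    Tendsto (fun n : ℕ => ∏ j ∈ Finset.range (n + 1), (1 + (y / (x + j)) ^ 2)) atTop
      (𝓝 (gammaRatioSq x y)) := by
  have hne : Complex.Gamma (x + y * Complex.I) ≠ 0 :=
    Complex.Gamma_ne_zero_of_re_pos (by simpa using hx)
  have h := (((Complex.GammaSeq_tendsto_Gamma (x : ℂ)).norm).div
    ((Complex.GammaSeq_tendsto_Gamma (x + y * Complex.I)).norm) (by simpa using hne)).pow 2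
  refine h.congr' ?_
  filter_upwards [eventually_gt_atTop 0] with n hn
  have hn' : (0 : ℝ) < n := by exact_mod_cast hn
  have h1 : ∀ j : ℕ, ‖(x : ℂ) + j‖ = x + j := fun j => by
    rw [← Complex.ofReal_natCast, ← Complex.ofReal_add, Complex.norm_real, Real.norm_of_nonneg]
    positivity
  have h2 : ∀ j : ℕ, ‖(x : ℂ) + y * Complex.I + j‖ ^ 2 = (x + j) ^ 2 + y ^ 2 := fun j => by
    rw [Complex.sq_norm, Complex.normSq_apply]
    simp
    ring
  simp only [Pi.div_apply, Complex.GammaSeq, norm_div, norm_mul, norm_prod,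
    Complex.norm_natCast_cpow_of_pos hn, Complex.add_re, Complex.ofReal_re, Complex.mul_re,
    Complex.I_re, Complex.ofReal_im, Complex.I_im, mul_zero, zero_mul, sub_zero, add_zero, h1,
    Complex.norm_natCast]
  rw [div_div_div_cancel_left' _ _ (by positivity), div_pow, ← Finset.prod_pow, ← Finset.prod_pow,
    ← Finset.prod_div_distrib]
  refine Finset.prod_congr rfl fun j _ => ?_
  have : x + j ≠ 0 := by positivity
  rw [h2]
  field_simp

lemma gammaRatioSq_le_of_le {x₁ x₂ : ℝ} (h₁ : 0 < x₁) (h : x₁ ≤ x₂) (y : ℝ) :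
    gammaRatioSq x₂ y ≤ gammaRatioSq x₁ y := by
  refine le_of_tendsto_of_tendsto' (tendsto_prod_gammaRatioSq (h₁.trans_le h) y)
    (tendsto_prod_gammaRatioSq h₁ y) fun n => ?_
  refine Finset.prod_le_prod (fun j _ => by positivity) fun j _ => ?_
  rw [div_pow, div_pow]
  gcongr

lemma Real.sq_rpow {c : ℝ} (hc : 0 ≤ c) (e : ℝ) : (c ^ 2) ^ e = (c ^ e) ^ 2 := by
  rw [← Real.rpow_natCast, ← Real.rpow_natCast, ← Real.rpow_mul hc, ← Real.rpow_mul hc, mul_comm]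

lemma Real.rpow_half_sq {c : ℝ} (hc : 0 ≤ c) (e : ℝ) : (c ^ (e / 2)) ^ 2 = c ^ e := by
  rw [← Real.rpow_mul_natCast hc]
  congr 1
  push_cast
  ring

lemma Real.exp_half_sq (a t : ℝ) : Real.exp (a / 2 * t) ^ 2 = Real.exp (a * t) := by
  rw [← Real.exp_nat_mul]
  congr 1
  push_cast
  ring

lemma one_add_div_sq_le_geom {a θ : ℝ} (ha : 0 < a) (h0 : 0 ≤ θ) (h1 : θ ≤ 1) (y : ℝ) :
    1 + (y / (a + θ)) ^ 2 ≤
      (1 + (y / a) ^ 2) ^ (1 - θ) * (1 + (y / (a + 1)) ^ 2) ^ θ := by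
  set u := (y / a) ^ 2 with hu
  set v := (y / (a + 1)) ^ 2 with hv
  have hu0 : 0 ≤ u := by positivity
  have hv0 : 0 ≤ v := by positivity
  have hθ : 0 ≤ 1 - θ := by linarith
  have hs : 1 - θ + θ = 1 := by ring
  have key : (y / (a + θ)) ^ 2 ≤ u ^ (1 - θ) * v ^ θ := by
    have hg := Real.geom_mean_le_arith_mean2_weighted hθ h0 ha.le
      (by linarith : (0 : ℝ) ≤ a + 1) hs
    have hg' : a ^ (1 - θ) * (a + 1) ^ θ ≤ a + θ := hg.trans (by linarith)
    have e : u ^ (1 - θ) * v ^ θ = y ^ 2 / (a ^ (1 - θ) * (a + 1) ^ θ) ^ 2 := by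
      rw [hu, hv, div_pow, div_pow, Real.div_rpow (by positivity) (by positivity),
        Real.div_rpow (by positivity) (by positivity), div_mul_div_comm,
        ← Real.rpow_add_of_nonneg (by positivity) hθ h0, hs, Real.rpow_one, mul_pow,
        Real.sq_rpow ha.le, Real.sq_rpow (by linarith)]
    rw [e, div_pow]
    gcongr
  -- Hölder's inequality `1 + u^(1-θ) v^θ ≤ (1+u)^(1-θ) (1+v)^θ`: the two weighted means are taken
  -- of normalised pairs, so that their arithmetic means add up to 1.
  have hA := Real.geom_mean_le_arith_mean2_weighted hθ h0
    (by positivity : 0 ≤ 1 / (1 + u)) (by positivity : 0 ≤ 1 / (1 + v)) hs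
  have hB := Real.geom_mean_le_arith_mean2_weighted hθ h0
    (by positivity : 0 ≤ u / (1 + u)) (by positivity : 0 ≤ v / (1 + v)) hs
  rw [Real.div_rpow (by positivity) (by positivity), Real.div_rpow (by positivity) (by positivity),
    div_mul_div_comm] at hA hB
  set D := (1 + u) ^ (1 - θ) * (1 + v) ^ θ with hD
  have hD0 : 0 < D := by positivity
  simp only [Real.one_rpow, mul_one] at hA
  have hsum : 1 / D + u ^ (1 - θ) * v ^ θ / D ≤ 1 := by
    refine (add_le_add hA hB).trans (le_of_eq ?_)
    field_simp
    ring
  rw [← add_div, div_le_one hD0] at hsum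
  linarith

/-- Interpolation holds factor by factor in the product. It turns the gain of a whole power of `1 +
y²` under `x ↦ x + 1` into a gain of a fractional power under `x ↦ x + θ`. -/
lemma gammaRatioSq_add_le_geom {a θ : ℝ} (ha : 0 < a) (h0 : 0 ≤ θ) (h1 : θ ≤ 1) (y : ℝ) :
    gammaRatioSq (a + θ) y ≤ gammaRatioSq a y ^ (1 - θ) * gammaRatioSq (a + 1) y ^ θ := by
  refine le_of_tendsto_of_tendsto' (tendsto_prod_gammaRatioSq (by linarith) y)
    (((tendsto_prod_gammaRatioSq ha y).rpow_const (Or.inr (by linarith))).mul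
      ((tendsto_prod_gammaRatioSq (by linarith : 0 < a + 1) y).rpow_const (Or.inr h0)))
      fun n => ?_
  rw [← Real.finsetProd_rpow _ _ (fun j _ => by positivity),
    ← Real.finsetProd_rpow _ _ (fun j _ => by positivity), ← Finset.prod_mul_distrib]
  refine Finset.prod_le_prod (fun j _ => by positivity) fun j _ => ?_
  have := one_add_div_sq_le_geom (a := a + j) (by positivity) h0 h1 y
  rwa [add_right_comm a θ, add_right_comm a 1]

lemma gammaRatioSq_add_one {x : ℝ} (hx : 0 < x) (y : ℝ) :
    gammaRatioSq (x + 1) y = gammaRatioSq x y / (1 + (y / x) ^ 2) := by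
  have hne : (x : ℂ) + y * Complex.I ≠ 0 := fun h => hx.ne' (by simpa using congrArg Complex.re h)
  have h1 : ‖(x : ℂ) + y * Complex.I‖ ^ 2 = x ^ 2 + y ^ 2 := by
    rw [Complex.sq_norm, Complex.normSq_apply]
    simp
    ring
  have hx' : (x : ℂ) ≠ 0 := by exact_mod_cast hx.ne'
  rw [gammaRatioSq, gammaRatioSq, Complex.ofReal_add, Complex.ofReal_one,
    Complex.Gamma_add_one _ hx', add_right_comm, Complex.Gamma_add_one _ hne, norm_mul, norm_mul,
    mul_div_mul_comm, mul_pow, div_pow, h1, Complex.norm_real, Real.norm_of_nonneg hx.le,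
    div_pow y]
  field_simp

/-- On `Re s = 1/2` one has `1 - s = conj s`, so the reflection formula computes `|Γ(s)|²` exactly.
-/
lemma gammaRatioSq_half (y : ℝ) : gammaRatioSq (1 / 2) y = Real.cosh (Real.pi * y) := by
  have hG : ‖Complex.Gamma ((1 / 2 : ℝ) : ℂ)‖ ^ 2 = Real.pi := by
    rw [Complex.Gamma_ofReal, Real.Gamma_one_half_eq, Complex.norm_real, Real.norm_eq_abs, sq_abs,
      Real.sq_sqrt Real.pi_pos.le]
  have hr := Complex.Gamma_mul_Gamma_one_sub (((1 / 2 : ℝ) : ℂ) + y * Complex.I)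
  have hc : (1 : ℂ) - (((1 / 2 : ℝ) : ℂ) + y * Complex.I) =
      (starRingEnd ℂ) (((1 / 2 : ℝ) : ℂ) + y * Complex.I) := by
    apply Complex.ext <;> simp
    norm_num
  have hs : Complex.sin (Real.pi * (((1 / 2 : ℝ) : ℂ) + y * Complex.I)) =
      (Real.cosh (Real.pi * y) : ℂ) := by
    have : (Real.pi : ℂ) * (((1 / 2 : ℝ) : ℂ) + y * Complex.I) =
        (Real.pi * y : ℝ) * Complex.I + Real.pi / 2 := by push_cast; ring
    rw [this, Complex.sin_add_pi_div_two, Complex.cos_mul_I, Complex.ofReal_cosh]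
  rw [hc, Complex.Gamma_conj, hs, Complex.mul_conj] at hr
  have h2 : ‖Complex.Gamma (((1 / 2 : ℝ) : ℂ) + y * Complex.I)‖ ^ 2 =
      Real.pi / Real.cosh (Real.pi * y) := by
    rw [Complex.sq_norm]
    exact_mod_cast hr
  have := Real.cosh_pos (Real.pi * y)
  rw [gammaRatioSq, div_pow, hG, h2, div_div_eq_mul_div, mul_div_cancel_left₀ _ Real.pi_pos.ne']

lemma Real.cosh_le_exp_abs (x : ℝ) : Real.cosh x ≤ Real.exp |x| := by
  rw [← Real.cosh_abs, Real.cosh_eq]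
  have : Real.exp (-|x|) ≤ Real.exp |x| := Real.exp_le_exp.2 (by linarith [abs_nonneg x])
  linarith

lemma Real.exp_abs_le_two_mul_cosh (x : ℝ) : Real.exp |x| ≤ 2 * Real.cosh x := by
  rw [← Real.cosh_abs, Real.cosh_eq]
  have := Real.exp_pos (-|x|)
  linarith

lemma norm_inv_Gamma_eq {x : ℝ} (hx : 0 < x) (y : ℝ) :
    ‖(Complex.Gamma (x + y * Complex.I))⁻¹‖ = √(gammaRatioSq x y) / Real.Gamma x := by
  have := Real.Gamma_pos_of_pos hx
  rw [gammaRatioSq, Real.sqrt_sq (by positivity), norm_inv, Complex.Gamma_ofReal,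
    Complex.norm_real, Real.norm_of_nonneg this.le]
  field_simp

/-- Interpolates between the exact value at `1/2` and the value at `3/2`, which is smaller by the
factor `1 + 4 y²`; monotonicity then covers all larger `x`. -/
lemma gammaRatioSq_le_rpow {x θ : ℝ} (h0 : 0 ≤ θ) (h1 : θ ≤ 1) (hx : 1 / 2 + θ ≤ x) (y : ℝ) :
    gammaRatioSq x y ≤ Real.exp (Real.pi * |y|) * (1 + y ^ 2) ^ (-θ) := by
  have hc := Real.cosh_pos (Real.pi * y)
  have hce : Real.cosh (Real.pi * y) ≤ Real.exp (Real.pi * |y|) := by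
    have := Real.cosh_le_exp_abs (Real.pi * y)
    rwa [abs_mul, abs_of_pos Real.pi_pos] at this
  refine (gammaRatioSq_le_of_le (by linarith) hx y).trans ?_
  refine (gammaRatioSq_add_le_geom (by norm_num) h0 h1 y).trans ?_
  rw [gammaRatioSq_add_one (by norm_num), gammaRatioSq_half, Real.div_rpow hc.le (by positivity),
    ← mul_div_assoc, ← Real.rpow_add hc, sub_add_cancel, Real.rpow_one, div_eq_mul_inv,
    ← Real.rpow_neg (by positivity)]
  refine mul_le_mul hce ?_ (by positivity) (by positivity)
  refine Real.rpow_le_rpow_of_nonpos (by positivity) ?_ (by linarith)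
  have : (y / (1 / 2)) ^ 2 = 4 * y ^ 2 := by ring
  nlinarith [sq_nonneg y]

lemma norm_inv_Gamma_le_rpow {x θ : ℝ} (h0 : 0 ≤ θ) (h1 : θ ≤ 1) (hx : 1 / 2 + θ ≤ x) (y : ℝ) :
    ‖(Complex.Gamma (x + y * Complex.I))⁻¹‖ ≤
      Real.exp (Real.pi / 2 * |y|) * (1 + y ^ 2) ^ (-θ / 2) / Real.Gamma x := by
  have hx0 : 0 < x := by linarith
  have hG := Real.Gamma_pos_of_pos hx0
  rw [norm_inv_Gamma_eq hx0]
  gcongr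
  refine Real.sqrt_le_iff.2 ⟨by positivity, (gammaRatioSq_le_rpow h0 h1 hx y).trans_eq ?_⟩
  rw [mul_pow, Real.exp_half_sq, Real.rpow_half_sq (by positivity)]

lemma norm_inv_Gamma_le {x : ℝ} (hx : 1 / 2 ≤ x) (y : ℝ) :
    ‖(Complex.Gamma (x + y * Complex.I))⁻¹‖ ≤ Real.exp (Real.pi / 2 * |y|) / Real.Gamma x := by
  simpa using norm_inv_Gamma_le_rpow le_rfl zero_le_one (by simpa using hx) y

lemma norm_inv_Gamma_le_rpow_add_one {x θ : ℝ} (h0 : 0 ≤ θ) (h1 : θ ≤ 1) (hx : 3 / 2 + θ ≤ x)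
    (y : ℝ) : ‖(Complex.Gamma (x + y * Complex.I))⁻¹‖ ≤
      3 / 2 * Real.exp (Real.pi / 2 * |y|) * (1 + y ^ 2) ^ (-(1 + θ) / 2) / Real.Gamma x := by
  have hx0 : 0 < x := by linarith
  have hG := Real.Gamma_pos_of_pos hx0
  rw [norm_inv_Gamma_eq hx0]
  gcongr
  refine Real.sqrt_le_iff.2 ⟨by positivity, ?_⟩
  have hmono := gammaRatioSq_le_of_le (by linarith : 0 < 1 / 2 + θ + 1)
    (by linarith : 1 / 2 + θ + 1 ≤ x) y
  rw [gammaRatioSq_add_one (by linarith)] at hmono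
  refine hmono.trans ?_
  have hb := gammaRatioSq_le_rpow h0 h1 le_rfl y
  -- `9/4 = (3/2)²` bounds `(1/2 + θ)²`, because `θ ≤ 1`.
  have hy : (1 + y ^ 2) / (9 / 4) ≤ 1 + (y / (1 / 2 + θ)) ^ 2 := by
    have : y ^ 2 / (9 / 4) ≤ (y / (1 / 2 + θ)) ^ 2 := by
      rw [div_pow]
      gcongr
      nlinarith
    rw [add_div]
    linarith
  refine (div_le_div₀ (by positivity) hb (by positivity) hy).trans_eq ?_
  have e : (1 + y ^ 2) ^ (-(1 + θ)) = (1 + y ^ 2) ^ (-θ) / (1 + y ^ 2) := by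
    rw [show -(1 + θ) = -θ - 1 by ring, Real.rpow_sub_one (by positivity)]
  rw [mul_pow, mul_pow, Real.rpow_half_sq (by positivity), Real.exp_half_sq, e]
  field_simp
  norm_num

/-- The Gamma integral over `[X, X + 1]` alone suffices: there `e^{-t} ≥ e^{-(X+1)}` and `t^(v-1) ≥
X^(v-1)`. Thus `Γ` outgrows every exponential, with an explicit constant. -/
lemma rpow_le_mul_Gamma {X v : ℝ} (hX : 0 < X) (hv : 1 ≤ v) :
    X ^ v ≤ X * Real.exp (X + 1) * Real.Gamma v := by
  have hint := Real.GammaIntegral_convergent (by linarith : 0 < v)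
  have hsub : Set.Ioc X (X + 1) ⊆ Set.Ioi 0 := fun t ht => hX.trans ht.1
  have h1 : Real.exp (-(X + 1)) * X ^ (v - 1) ≤ Real.Gamma v := by
    rw [Real.Gamma_eq_integral (by linarith)]
    refine le_trans ?_ (MeasureTheory.setIntegral_mono_set hint ?_ hsub.eventuallyLE)
    · have h := MeasureTheory.setIntegral_ge_of_const_le_real (μ := MeasureTheory.volume)
        (s := Set.Ioc X (X + 1)) (c := Real.exp (-(X + 1)) * X ^ (v - 1))
        (f := fun t => Real.exp (-t) * t ^ (v - 1)) measurableSet_Ioc (by simp) (fun t ht => by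
          have := ht.1
          have := ht.2
          gcongr) (hint.mono_set hsub)
      simpa using h
    · filter_upwards [MeasureTheory.ae_restrict_mem measurableSet_Ioi] with t ht
      have : 0 < t := ht
      simp only [Pi.zero_apply]
      positivity
  have h2 : X ^ v = X * X ^ (v - 1) := by rw [Real.rpow_sub_one hX.ne']; field_simp
  have h3 : X ^ (v - 1) ≤ Real.exp (X + 1) * Real.Gamma v := by
    rw [Real.exp_neg] at h1
    rwa [inv_mul_le_iff₀ (Real.exp_pos _)] at h1
  rw [h2, mul_assoc]
  gcongr

lemma exp_neg_two_le_Gamma {x : ℝ} (hx : 1 / 2 ≤ x) : Real.exp (-2) ≤ Real.Gamma x := by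
  have key : ∀ v : ℝ, 1 ≤ v → Real.exp (-2) ≤ Real.Gamma v := fun v hv => by
    have := rpow_le_mul_Gamma one_pos hv
    rw [Real.one_rpow, one_mul] at this
    rw [Real.exp_neg, inv_le_iff_one_le_mul₀ (Real.exp_pos _), mul_comm]
    norm_num at this
    exact this
  rcases le_total 1 x with h | h
  · exact key x h
  · have h1 := key (x + 1) (by linarith)
    rw [Real.Gamma_add_one (by linarith)] at h1
    have := Real.Gamma_pos_of_pos (by linarith : 0 < x)
    nlinarith

lemma exists_rpow_div_Gamma_le {X δ : ℝ} (hX : 0 < X) (hδ : 0 < δ) :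
    ∃ C : ℝ, 0 ≤ C ∧ ∀ u : ℝ, 1 ≤ δ * u → X ^ u / Real.Gamma (δ * u) ≤ C * 2 ^ (-u) := by
  -- Chosen so that `Y^(δ u) = 2^u X^u`; the surplus `2^u` becomes the geometric decay.
  set Y := (2 * X) ^ (1 / δ) with hY
  have hYp : 0 < Y := by positivity
  refine ⟨Y * Real.exp (Y + 1), by positivity, fun u hu => ?_⟩
  have hG := Real.Gamma_pos_of_pos (by linarith : 0 < δ * u)
  have h := rpow_le_mul_Gamma hYp hu
  have e : Y ^ (δ * u) = 2 ^ u * X ^ u := by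
    rw [hY, ← Real.rpow_mul (by positivity), ← mul_assoc, one_div_mul_cancel hδ.ne', one_mul,
      Real.mul_rpow zero_le_two hX.le]
  rw [e] at h
  rw [div_le_iff₀ hG, Real.rpow_neg zero_le_two, mul_right_comm, ← div_eq_mul_inv,
    le_div_iff₀ (by positivity), mul_comm]
  exact h

/-- Each step to the left uses `1 / Γ(w) = w / Γ(w + 1)`; the linear factor `w` is absorbed by half
of `ε`, which is why `ε` is quantified inside the induction. -/
lemma norm_inv_Gamma_le_strip (k : ℕ) : ∀ ε : ℝ, 0 < ε → ∀ B : ℝ, ∃ C : ℝ, 0 ≤ C ∧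
    ∀ w : ℂ, 1 / 2 - k ≤ w.re → w.re ≤ B →
      ‖(Complex.Gamma w)⁻¹‖ ≤ C * Real.exp ((Real.pi / 2 + ε) * |w.im|) := by
  have base : ∀ ε : ℝ, 0 < ε → ∀ w : ℂ, 1 / 2 ≤ w.re →
      ‖(Complex.Gamma w)⁻¹‖ ≤ Real.exp 2 * Real.exp ((Real.pi / 2 + ε) * |w.im|) := by
    intro ε hε w hw
    have h := norm_inv_Gamma_le hw w.im
    rw [Complex.re_add_im] at h
    refine h.trans ?_
    rw [div_eq_mul_inv, mul_comm]
    gcongr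
    · rw [← neg_neg (2 : ℝ), Real.exp_neg]
      gcongr
      simpa using exp_neg_two_le_Gamma hw
    · linarith
  induction k with
  | zero =>
    intro ε hε B
    exact ⟨Real.exp 2, by positivity, fun w hw _ => base ε hε w (by simpa using hw)⟩
  | succ k ih =>
    intro ε hε B
    obtain ⟨C, hC, h⟩ := ih (ε / 2) (by linarith) (B + 1)
    have hM : 0 ≤ |1 / 2 - (k + 1 : ℝ)| + |B| + 2 / ε := by positivity
    refine ⟨(|1 / 2 - (k + 1 : ℝ)| + |B| + 2 / ε) * C, by positivity, fun w h1 h2 => ?_⟩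
    push_cast at h1
    have hw := h (w + 1) (by simp; linarith) (by simpa using h2)
    have hre : |w.re| ≤ |1 / 2 - (k + 1 : ℝ)| + |B| := by
      rw [abs_le]
      constructor
      · linarith [neg_abs_le (1 / 2 - (k + 1 : ℝ)), abs_nonneg B]
      · linarith [le_abs_self B, abs_nonneg (1 / 2 - (k + 1 : ℝ))]
    have hE : 1 ≤ Real.exp (ε / 2 * |w.im|) := Real.one_le_exp (by positivity)
    have him : |w.im| ≤ 2 / ε * Real.exp (ε / 2 * |w.im|) := by
      have := Real.add_one_le_exp (ε / 2 * |w.im|)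
      rw [div_mul_eq_mul_div, le_div_iff₀ hε]
      nlinarith
    have hn : ‖w‖ ≤ (|1 / 2 - (k + 1 : ℝ)| + |B| + 2 / ε) * Real.exp (ε / 2 * |w.im|) := by
      refine (Complex.norm_le_abs_re_add_abs_im w).trans ?_
      rw [add_mul]
      refine add_le_add (hre.trans ?_) him
      exact le_mul_of_one_le_right (by positivity) hE
    rcases eq_or_ne w 0 with rfl | hw0
    · simp only [Complex.Gamma_zero, inv_zero, norm_zero]
      positivity
    have e : (Complex.Gamma w)⁻¹ = w * (Complex.Gamma (w + 1))⁻¹ := by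
      rw [Complex.Gamma_add_one w hw0, mul_inv, mul_inv_cancel_left₀ hw0]
    rw [e, norm_mul]
    refine (mul_le_mul hn hw (norm_nonneg _) (by positivity)).trans_eq ?_
    rw [mul_mul_mul_comm, ← Real.exp_add]
    simp only [Complex.add_im, Complex.one_im, add_zero]
    congr 2
    ring

lemma exists_norm_inv_Gamma_le_strip {ε : ℝ} (hε : 0 < ε) (A B : ℝ) : ∃ C : ℝ, 0 ≤ C ∧
    ∀ w : ℂ, A ≤ w.re → w.re ≤ B →
      ‖(Complex.Gamma w)⁻¹‖ ≤ C * Real.exp ((Real.pi / 2 + ε) * |w.im|) := by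
  obtain ⟨k, hk⟩ := exists_nat_ge (1 / 2 - A)
  obtain ⟨C, hC, h⟩ := norm_inv_Gamma_le_strip k ε hε B
  exact ⟨C, hC, fun w h1 h2 => h w (by linarith) h2⟩

/-! ### Quotients of Gamma values through the Beta integral -/

lemma norm_betaIntegral_le_one {a d : ℂ} (ha : 1 ≤ a.re) (hd : 1 ≤ d.re) :
    ‖Complex.betaIntegral a d‖ ≤ 1 := by
  have h : ∀ x ∈ Set.uIoc (0 : ℝ) 1,
      ‖(x : ℂ) ^ (a - 1) * (1 - (x : ℂ)) ^ (d - 1)‖ ≤ 1 := fun x hx => by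
    rw [Set.uIoc_of_le zero_le_one] at hx
    rw [norm_mul, Complex.norm_cpow_eq_rpow_re_of_pos hx.1]
    refine mul_le_one₀ (Real.rpow_le_one hx.1.le hx.2 (by simpa using ha)) (norm_nonneg _) ?_
    rw [← Complex.ofReal_one, ← Complex.ofReal_sub]
    rcases hx.2.eq_or_lt with rfl | hlt
    · rw [sub_self, Complex.ofReal_zero]
      rcases eq_or_ne (d - 1) 0 with h0 | h0
      · simp [h0]
      · simp [Complex.zero_cpow h0]
    · rw [Complex.norm_cpow_eq_rpow_re_of_pos (by linarith)]
      exact Real.rpow_le_one (by linarith) (by linarith [hx.1]) (by simpa using hd)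
  simpa [Complex.betaIntegral] using intervalIntegral.norm_integral_le_of_norm_le_const h

lemma norm_Gamma_mul_inv_Gamma_add_le {a d : ℂ} (ha : 1 ≤ a.re) (hd : 1 ≤ d.re) :
    ‖Complex.Gamma a * (Complex.Gamma (a + d))⁻¹‖ ≤ ‖(Complex.Gamma d)⁻¹‖ := by
  have h := Complex.Gamma_mul_Gamma_eq_betaIntegral (by linarith : 0 < a.re)
    (by linarith : 0 < d.re)
  have h1 : Complex.Gamma (a + d) ≠ 0 :=
    Complex.Gamma_ne_zero_of_re_pos (by rw [Complex.add_re]; linarith)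
  have h2 : Complex.Gamma d ≠ 0 := Complex.Gamma_ne_zero_of_re_pos (by linarith)
  have e : Complex.Gamma a * (Complex.Gamma (a + d))⁻¹ =
      Complex.betaIntegral a d * (Complex.Gamma d)⁻¹ := by
    field_simp
    rw [h, mul_comm]
  rw [e, norm_mul]
  exact mul_le_of_le_one_left (norm_nonneg _) (norm_betaIntegral_le_one ha hd)

/-! ### Shifting contours past the poles of `π / sin (π s)` -/

/-- The integral of `F` over the segment from `σ - iS` to `σ + iT`, in the real parameter. -/
noncomputable def vertInt (F : ℂ → ℂ) (σ : ℝ) (p : ℝ × ℝ) : ℂ :=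
  ∫ t in (-p.1)..p.2, F (σ + t * Complex.I)

/-- `F` tends to zero uniformly at both ends of the strip `a ≤ Re s ≤ b`. -/
def DecaysOn (F : ℂ → ℂ) (a b : ℝ) : Prop :=
  ∃ η : ℝ → ℝ, Tendsto η atTop (𝓝 0) ∧
    ∀ s : ℂ, a ≤ s.re → s.re ≤ b → 1 ≤ |s.im| → ‖F s‖ ≤ η |s.im|

lemma DecaysOn.mono {F : ℂ → ℂ} {a b a' b' : ℝ} (h : DecaysOn F a b) (ha : a ≤ a')
    (hb : b' ≤ b) : DecaysOn F a' b' := by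
  obtain ⟨η, h1, h2⟩ := h
  exact ⟨η, h1, fun s hs1 hs2 => h2 s (ha.trans hs1) (hs2.trans hb)⟩

/-- Cauchy's theorem on a rectangle: the horizontal sides vanish separately, so its two heights may
tend to infinity independently. -/
lemma tendsto_vertInt_sub {F : ℂ → ℂ} {a b : ℝ} (hab : a ≤ b)
    (hF : DifferentiableOn ℂ F {s | a ≤ s.re ∧ s.re ≤ b}) (hd : DecaysOn F a b) :
    Tendsto (fun p => vertInt F b p - vertInt F a p) (atTop ×ˢ atTop) (𝓝 0) := by
  obtain ⟨η, hη, hle⟩ := hd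
  have hlim : Tendsto (fun p : ℝ × ℝ => η p.1 * (b - a) + η p.2 * (b - a)) (atTop ×ˢ atTop)
      (𝓝 0) := by
    have h1 := (hη.comp (tendsto_fst (f := atTop) (g := (atTop : Filter ℝ)))).mul_const (b - a)
    have h2 := (hη.comp (tendsto_snd (g := atTop) (f := (atTop : Filter ℝ)))).mul_const (b - a)
    simpa using h1.add h2
  refine squeeze_zero_norm' ?_ hlim
  filter_upwards [(eventually_ge_atTop (1 : ℝ)).prod_mk (eventually_ge_atTop (1 : ℝ))] with p hp
  obtain ⟨hS, hT⟩ := hp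
  have hrect := Complex.integral_boundary_rect_eq_zero_of_differentiableOn F
    (a + (-p.1 : ℝ) * Complex.I) (b + p.2 * Complex.I) (hF.mono fun s hs => by
      have := hs.1
      simp only [Set.mem_preimage, Complex.add_re, Complex.ofReal_re, Complex.mul_re,
        Complex.I_re, Complex.ofReal_im, Complex.I_im, mul_zero, zero_mul, sub_zero,
        add_zero, Set.uIcc_of_le hab] at this
      exact this)
  simp only [Complex.add_re, Complex.ofReal_re, Complex.mul_re, Complex.I_re, Complex.ofReal_im,
    Complex.I_im, mul_zero, sub_zero, add_zero, Complex.add_im, Complex.mul_im,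
    mul_one, zero_add] at hrect
  have hbot : ‖∫ x : ℝ in a..b, F (x + (-p.1 : ℝ) * Complex.I)‖ ≤ η p.1 * (b - a) := by
    have := intervalIntegral.norm_integral_le_of_norm_le_const (a := a) (b := b)
      (f := fun x : ℝ => F (x + (-p.1 : ℝ) * Complex.I)) (C := η p.1) (fun x hx => by
        rw [Set.uIoc_of_le hab] at hx
        have := hle (x + (-p.1 : ℝ) * Complex.I) (by simpa using hx.1.le) (by simpa using hx.2)
          (by simpa [abs_of_pos (by linarith : 0 < p.1)] using hS)
        simpa [abs_of_pos (by linarith : 0 < p.1)] using this)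
    rwa [abs_of_nonneg (by linarith)] at this
  have htop : ‖∫ x : ℝ in a..b, F (x + p.2 * Complex.I)‖ ≤ η p.2 * (b - a) := by
    have := intervalIntegral.norm_integral_le_of_norm_le_const (a := a) (b := b)
      (f := fun x : ℝ => F (x + p.2 * Complex.I)) (C := η p.2) (fun x hx => by
        rw [Set.uIoc_of_le hab] at hx
        have := hle (x + p.2 * Complex.I) (by simpa using hx.1.le) (by simpa using hx.2)
          (by simpa [abs_of_pos (by linarith : 0 < p.2)] using hT)
        simpa [abs_of_pos (by linarith : 0 < p.2)] using this)
    rwa [abs_of_nonneg (by linarith)] at this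
  have e : Complex.I * (vertInt F b p - vertInt F a p) =
      (∫ x : ℝ in a..b, F (x + p.2 * Complex.I)) -
        ∫ x : ℝ in a..b, F (x + (-p.1 : ℝ) * Complex.I) := by
    simp only [smul_eq_mul] at hrect
    simp only [vertInt]
    linear_combination hrect
  have e' : ‖vertInt F b p - vertInt F a p‖ =
      ‖Complex.I * (vertInt F b p - vertInt F a p)‖ := by simp
  rw [e', e]
  refine (norm_sub_le _ _).trans ?_
  linarith

lemma norm_sin_pi_mul_sq (σ t : ℝ) : ‖Complex.sin (Real.pi * (σ + t * Complex.I))‖ ^ 2 =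
    Real.sin (Real.pi * σ) ^ 2 + Real.sinh (Real.pi * t) ^ 2 := by
  have e : (Real.pi : ℂ) * (σ + t * Complex.I) =
      (Real.pi * σ : ℝ) + (Real.pi * t : ℝ) * Complex.I := by push_cast; ring
  rw [e, Complex.sin_add_mul_I, ← Complex.ofReal_sin, ← Complex.ofReal_cos, ← Complex.ofReal_cosh,
    ← Complex.ofReal_sinh, Complex.sq_norm, Complex.normSq_apply]
  simp only [Complex.add_re, Complex.mul_re, Complex.ofReal_re, Complex.ofReal_im, Complex.I_re,
    Complex.I_im, Complex.add_im, Complex.mul_im]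
  have h1 := Real.cosh_sq (Real.pi * t)
  have h2 := Real.sin_sq_add_cos_sq (Real.pi * σ)
  linear_combination Real.sin (Real.pi * σ) ^ 2 * h1 +
    Real.sinh (Real.pi * t) ^ 2 * h2

lemma abs_sin_mul_cosh_le (σ t : ℝ) : |Real.sin (Real.pi * σ)| * Real.cosh (Real.pi * t) ≤
    ‖Complex.sin (Real.pi * (σ + t * Complex.I))‖ := by
  refine le_of_sq_le_sq ?_ (norm_nonneg _)
  rw [norm_sin_pi_mul_sq, mul_pow, sq_abs, Real.cosh_sq]
  nlinarith [Real.sin_sq_le_one (Real.pi * σ), sq_nonneg (Real.sinh (Real.pi * t))]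

/-- `|sin|² ≥ sinh² = cosh² - 1`, and `cosh ≥ 2` once `|Im s| ≥ 1`; the bound does not depend on `Re
s`. -/
lemma cosh_le_two_mul_norm_sin (s : ℂ) (h : 1 ≤ |s.im|) :
    Real.cosh (Real.pi * s.im) ≤ 2 * ‖Complex.sin (Real.pi * s)‖ := by
  have h0 := norm_sin_pi_mul_sq s.re s.im
  rw [Complex.re_add_im] at h0
  have h2 : 2 ≤ Real.cosh (Real.pi * s.im) := by
    have h3 := Real.exp_abs_le_two_mul_cosh (Real.pi * s.im)
    have h4 := Real.add_one_le_exp |Real.pi * s.im|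
    rw [abs_mul, abs_of_pos Real.pi_pos] at h3 h4
    nlinarith [Real.pi_gt_three]
  refine le_of_sq_le_sq ?_ (by positivity)
  rw [mul_pow, h0]
  nlinarith [Real.cosh_sq (Real.pi * s.im), sq_nonneg (Real.sin (Real.pi * s.re))]

lemma sin_pi_mul_ne_zero_of_forall_ne {s : ℂ} (h : ∀ k : ℤ, s ≠ k) : Complex.sin (Real.pi * s) ≠ 0 := by
  intro h0
  obtain ⟨k, hk⟩ := Complex.sin_eq_zero_iff.1 h0
  refine h k (mul_left_cancel₀ (Complex.ofReal_ne_zero.2 Real.pi_ne_zero) ?_)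
  rw [hk, mul_comm]

lemma sin_pi_mul_ne_zero_of_re {c : ℝ} (h0 : 0 < c) (h1 : c < 1) (n : ℤ) {s : ℂ}
    (hs : s.re = c - n) : Complex.sin (Real.pi * s) ≠ 0 := by
  refine sin_pi_mul_ne_zero_of_forall_ne fun k hk => ?_
  rw [hk, Complex.intCast_re] at hs
  have h2 : ((k + n : ℤ) : ℝ) = c := by push_cast; linarith
  rw [← h2] at h0 h1
  have h3 : 0 < k + n := by exact_mod_cast h0
  have h4 : k + n < 1 := by exact_mod_cast h1
  omega

/-- The kernel `π / sin (π s)`. -/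
noncomputable def cscKernel (s : ℂ) : ℂ := Real.pi / Complex.sin (Real.pi * s)

lemma cscKernel_sub_nat (s : ℂ) (n : ℕ) : cscKernel (s - n) = (-1) ^ n * cscKernel s := by
  have : Complex.sin (Real.pi * (s - n)) = (-1) ^ n * Complex.sin (Real.pi * s) := by
    rw [mul_sub, mul_comm (Real.pi : ℂ) (n : ℂ), Complex.sin_antiperiodic.sub_nat_mul_eq]
  rw [cscKernel, cscKernel, this]
  rcases neg_one_pow_eq_or ℂ n with h | h <;> simp [h, div_neg]

lemma norm_cscKernel_le {s : ℂ} (h : 1 ≤ |s.im|) :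
    ‖cscKernel s‖ ≤ 2 * Real.pi / Real.cosh (Real.pi * s.im) := by
  have h1 := cosh_le_two_mul_norm_sin s h
  have h2 := Real.cosh_pos (Real.pi * s.im)
  have h3 : 0 < ‖Complex.sin (Real.pi * s)‖ := by linarith
  rw [cscKernel, norm_div, Complex.norm_real, Real.norm_of_nonneg Real.pi_pos.le,
    div_le_div_iff₀ h3 h2]
  nlinarith [Real.pi_pos]

lemma differentiableAt_cscKernel {s : ℂ} (h : Complex.sin (Real.pi * s) ≠ 0) :
    DifferentiableAt ℂ cscKernel s := by
  unfold cscKernel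
  fun_prop (disch := exact h)

lemma tendsto_inv_cosh_pi : Tendsto (fun t : ℝ => (Real.cosh (Real.pi * t))⁻¹) atTop (𝓝 0) := by
  refine tendsto_inv_atTop_zero.comp (tendsto_atTop_mono (f := fun t => t / 2) (fun t => ?_)
    (tendsto_id.atTop_div_const two_pos))
  have h1 := Real.exp_abs_le_two_mul_cosh (Real.pi * t)
  have h2 := Real.add_one_le_exp |Real.pi * t|
  rw [abs_mul, abs_of_pos Real.pi_pos] at h1 h2
  nlinarith [Real.pi_gt_three, le_abs_self t, abs_nonneg t]

lemma decaysOn_cscKernel (a b : ℝ) : DecaysOn cscKernel a b := by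
  refine ⟨fun t => 2 * Real.pi * (Real.cosh (Real.pi * t))⁻¹, ?_, fun s _ _ h => ?_⟩
  · simpa using tendsto_inv_cosh_pi.const_mul (2 * Real.pi)
  · have e : Real.cosh (Real.pi * |s.im|) = Real.cosh (Real.pi * s.im) := by
      rw [← Real.cosh_abs (Real.pi * s.im), abs_mul, abs_of_pos Real.pi_pos]
    simpa only [e, div_eq_mul_inv] using norm_cscKernel_le h

/-- On this line the kernel is `π / cosh (π t)`, with antiderivative `arctan (sinh (π t))`. This one
explicit integral stands in for all residue computations. -/
lemma tendsto_vertInt_cscKernel_half :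
    Tendsto (vertInt cscKernel (1 / 2 : ℝ)) (atTop ×ˢ atTop) (𝓝 Real.pi) := by
  have hval : ∀ t : ℝ, cscKernel ((1 / 2 : ℝ) + t * Complex.I) =
      ((Real.pi / Real.cosh (Real.pi * t) : ℝ) : ℂ) := fun t => by
    have : (Real.pi : ℂ) * (((1 / 2 : ℝ) : ℂ) + t * Complex.I) =
        (Real.pi * t : ℝ) * Complex.I + Real.pi / 2 := by push_cast; ring
    rw [cscKernel, this, Complex.sin_add_pi_div_two, Complex.cos_mul_I, ← Complex.ofReal_cosh,
      ← Complex.ofReal_div]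
  have hder : ∀ t : ℝ, HasDerivAt (fun t => Real.arctan (Real.sinh (Real.pi * t)))
      (Real.pi / Real.cosh (Real.pi * t)) t := fun t => by
    have h := (((hasDerivAt_id t).const_mul Real.pi).sinh).arctan
    refine h.congr_deriv ?_
    have := (Real.cosh_pos (Real.pi * t)).ne'
    simp only [id, mul_one]
    rw [add_comm, ← Real.cosh_sq]
    field_simp
  have hI : ∀ p : ℝ × ℝ, vertInt cscKernel (1 / 2 : ℝ) p =
      ((Real.arctan (Real.sinh (Real.pi * p.2)) +
        Real.arctan (Real.sinh (Real.pi * p.1)) : ℝ) : ℂ) := fun p => by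
    simp only [vertInt, hval]
    rw [intervalIntegral.integral_ofReal, intervalIntegral.integral_eq_sub_of_hasDerivAt
      (fun t _ => hder t) ?_]
    · rw [mul_neg, Real.sinh_neg, Real.arctan_neg, sub_neg_eq_add]
    · refine Continuous.intervalIntegrable ?_ _ _
      exact continuous_const.div (by fun_prop) fun t => (Real.cosh_pos _).ne'
  have hl : Tendsto (fun t => Real.arctan (Real.sinh (Real.pi * t))) atTop (𝓝 (Real.pi / 2)) := by
    refine (Real.tendsto_arctan_atTop.mono_right nhdsWithin_le_nhds).comp ?_
    refine tendsto_atTop_mono' _ ?_ tendsto_id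
    filter_upwards [eventually_ge_atTop 0] with t ht
    refine le_trans ?_ (Real.self_le_sinh_iff.2 (by positivity))
    simp only [id]
    nlinarith [Real.pi_gt_three]
  rw [show vertInt cscKernel (1 / 2 : ℝ) = _ from funext hI]
  have := (hl.comp (tendsto_snd (g := atTop) (f := (atTop : Filter ℝ)))).add
    (hl.comp (tendsto_fst (f := atTop) (g := (atTop : Filter ℝ))))
  rw [add_halves] at this
  exact (Complex.continuous_ofReal.tendsto _).comp this

lemma sin_pi_mul_ne_zero_of_mem_Ioo {s : ℂ} (h0 : 0 < s.re) (h1 : s.re < 1) :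
    Complex.sin (Real.pi * s) ≠ 0 :=
  sin_pi_mul_ne_zero_of_re h0 h1 0 (by simp)

lemma tendsto_vertInt_cscKernel {c : ℝ} (h0 : 0 < c) (h1 : c < 1) :
    Tendsto (vertInt cscKernel c) (atTop ×ˢ atTop) (𝓝 Real.pi) := by
  rcases le_total c (1 / 2) with h | h
  · have := tendsto_vertInt_sub h (fun s hs => (differentiableAt_cscKernel
      (sin_pi_mul_ne_zero_of_mem_Ioo (h0.trans_le hs.1) (hs.2.trans_lt
        (by norm_num)))).differentiableWithinAt) (decaysOn_cscKernel _ _)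
    simpa using tendsto_vertInt_cscKernel_half.sub this
  · have := tendsto_vertInt_sub h (fun s hs => (differentiableAt_cscKernel
      (sin_pi_mul_ne_zero_of_mem_Ioo (lt_of_lt_of_le (by norm_num) hs.1)
        (hs.2.trans_lt h1))).differentiableWithinAt) (decaysOn_cscKernel _ _)
    simpa using tendsto_vertInt_cscKernel_half.add this

lemma vertInt_cscKernel_sub_nat (c : ℝ) (n : ℕ) (p : ℝ × ℝ) :
    vertInt cscKernel (c - n) p = (-1) ^ n * vertInt cscKernel c p := by
  simp only [vertInt]
  rw [← intervalIntegral.integral_const_mul]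
  congr 1
  ext t
  rw [← cscKernel_sub_nat]
  congr 1
  push_cast
  ring

lemma differentiable_sin_pi_mul : Differentiable ℂ fun s : ℂ => Complex.sin (Real.pi * s) := by
  fun_prop

lemma sin_pi_mul_neg_nat (n : ℕ) : Complex.sin (Real.pi * (-(n : ℂ))) = 0 := by
  rw [mul_neg, Complex.sin_neg, mul_comm, Complex.sin_nat_mul_pi, neg_zero]

/-- The quotient of slopes extends `π (H(s) - H(-n)) / sin (π s)` across `-n`, where the slope of
the sine is its nonzero derivative; the sine has no other zero in the strip. -/
lemma differentiableOn_dslope_div_dslope_sin {H : ℂ → ℂ} (hH : Differentiable ℂ H) {c : ℝ}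
    (h0 : 0 < c) (h1 : c < 1) (n : ℕ) :
    DifferentiableOn ℂ (fun s => Real.pi * dslope H (-(n : ℂ)) s /
      dslope (fun s : ℂ => Complex.sin (Real.pi * s)) (-(n : ℂ)) s)
      {s | c - (n + 1 : ℕ) ≤ s.re ∧ s.re ≤ c - n} := by
  have d1 := (differentiableOn_univ.1 ((Complex.differentiableOn_dslope
    (c := -(n : ℂ)) univ_mem).2 hH.differentiableOn))
  have d2 := (differentiableOn_univ.1 ((Complex.differentiableOn_dslope
    (c := -(n : ℂ)) univ_mem).2 differentiable_sin_pi_mul.differentiableOn))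
  intro s hs
  refine (DifferentiableAt.div (d1.const_mul _ s) (d2 s) ?_).differentiableWithinAt
  rcases eq_or_ne s (-(n : ℂ)) with rfl | hne
  · have hder : HasDerivAt (fun s : ℂ => Complex.sin (Real.pi * s))
        (Complex.cos (Real.pi * (-(n : ℂ))) * (Real.pi * 1)) (-(n : ℂ)) :=
      ((hasDerivAt_id _).const_mul _).csin
    rw [dslope_same, hder.deriv]
    intro h
    have hc : Complex.cos (Real.pi * (-(n : ℂ))) = 0 := by simpa [Real.pi_ne_zero] using h
    have := Complex.sin_sq_add_cos_sq (Real.pi * (-(n : ℂ)))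
    rw [hc, sin_pi_mul_neg_nat] at this
    norm_num at this
  · rw [dslope_of_ne _ hne, slope_def_field, sin_pi_mul_neg_nat, sub_zero]
    refine div_ne_zero (sin_pi_mul_ne_zero_of_forall_ne fun k hk => hne ?_) (sub_ne_zero.2 hne)
    obtain ⟨ha, hb⟩ := hs
    rw [hk, Complex.intCast_re] at ha hb
    have ha' : (-((n : ℤ) + 1 : ℤ) : ℝ) < k := by push_cast at ha ⊢; linarith
    have hb' : (k : ℝ) < ((1 - n : ℤ) : ℝ) := by push_cast; linarith
    have ha2 : -((n : ℤ) + 1) < k := by exact_mod_cast ha'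
    have hb2 : k < 1 - n := by exact_mod_cast hb'
    have : k = -(n : ℤ) := by omega
    rw [hk, this]
    push_cast
    rfl

lemma continuous_cscKernel_line {c : ℝ} (h0 : 0 < c) (h1 : c < 1) (n : ℕ) :
    Continuous fun t : ℝ => cscKernel ((c - n : ℝ) + t * Complex.I) := by
  refine continuous_iff_continuousAt.2 fun t => ?_
  have := (differentiableAt_cscKernel (sin_pi_mul_ne_zero_of_re h0 h1 n
    (s := ((c - n : ℝ) : ℂ) + t * Complex.I) (by simp))).continuousAt
  exact ContinuousAt.comp (f := fun t : ℝ => ((c - n : ℝ) : ℂ) + t * Complex.I) this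
    (by fun_prop)

/-- Without the residue theorem: subtracting `H(-n) π / sin (π s)` removes the pole, so Cauchy's
theorem applies to the difference. The subtracted term is known on both lines: its integral tends to
`π` on `Re s = c`, and antiperiodicity transports this with signs `(-1)^n` and `(-1)^(n+1)`.
Together these give `2π (-1)^n H(-n)`. -/
lemma tendsto_vertInt_cscKernel_mul_sub {H : ℂ → ℂ} (hH : Differentiable ℂ H) {c : ℝ}
    (h0 : 0 < c) (h1 : c < 1) (n : ℕ)
    (hd : DecaysOn (fun s => cscKernel s * H s) (c - (n + 1 : ℕ)) (c - n)) :
    Tendsto (fun p => vertInt (fun s => cscKernel s * H s) (c - n) p -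
      vertInt (fun s => cscKernel s * H s) (c - (n + 1 : ℕ)) p) (atTop ×ˢ atTop)
      (𝓝 (2 * Real.pi * ((-1) ^ n * H (-(n : ℂ))))) := by
  set F : ℂ → ℂ := fun s => Real.pi * dslope H (-(n : ℂ)) s /
      dslope (fun s : ℂ => Complex.sin (Real.pi * s)) (-(n : ℂ)) s with hFdef
  have hF : ∀ s : ℂ, s ≠ -(n : ℂ) → F s = cscKernel s * H s - H (-(n : ℂ)) * cscKernel s := by
    intro s hs
    have := sub_ne_zero.2 hs
    rw [hFdef]
    simp only [dslope_of_ne _ hs, slope_def_field, sin_pi_mul_neg_nat, sub_zero, cscKernel]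
    rw [← mul_div_assoc, div_div_div_cancel_right₀ this]
    ring
  have hFd : DecaysOn F (c - (n + 1 : ℕ)) (c - n) := by
    obtain ⟨η, hη, hle⟩ := hd
    obtain ⟨ξ, hξ, hle'⟩ := decaysOn_cscKernel (c - (n + 1 : ℕ)) (c - n)
    refine ⟨fun t => η t + ‖H (-(n : ℂ))‖ * ξ t, by simpa using hη.add (hξ.const_mul _),
      fun s h2 h3 h4 => ?_⟩
    rw [hF s fun h => by rw [h] at h4; norm_num at h4]
    refine (norm_sub_le _ _).trans (add_le_add (hle s h2 h3 h4) ?_)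
    rw [norm_mul]
    exact mul_le_mul_of_nonneg_left (hle' s h2 h3 h4) (norm_nonneg _)
  have hlim := tendsto_vertInt_sub (by push_cast; linarith)
    (differentiableOn_dslope_div_dslope_sin hH h0 h1 n) hFd
  have hline : ∀ (m : ℕ) (p : ℝ × ℝ), vertInt F (c - m) p =
      vertInt (fun s => cscKernel s * H s) (c - m) p -
        H (-(n : ℂ)) * ((-1) ^ m * vertInt cscKernel c p) := by
    intro m p
    rw [← vertInt_cscKernel_sub_nat]
    simp only [vertInt]
    have hc := continuous_cscKernel_line h0 h1 m
    have hHc : Continuous fun t : ℝ => H ((c - m : ℝ) + t * Complex.I) :=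
      hH.continuous.comp (by fun_prop)
    have i1 : IntervalIntegrable (fun t : ℝ => cscKernel ((c - m : ℝ) + t * Complex.I) *
        H ((c - m : ℝ) + t * Complex.I)) MeasureTheory.volume (-p.1) p.2 :=
      (hc.mul hHc).intervalIntegrable _ _
    have i2 : IntervalIntegrable (fun t : ℝ => H (-(n : ℂ)) *
        cscKernel ((c - m : ℝ) + t * Complex.I)) MeasureTheory.volume (-p.1) p.2 :=
      (continuous_const.mul hc).intervalIntegrable _ _
    rw [← intervalIntegral.integral_const_mul, ← intervalIntegral.integral_sub i1 i2]
    congr 1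
    ext t
    refine hF _ fun h => sin_pi_mul_ne_zero_of_re h0 h1 m
      (s := ((c - m : ℝ) : ℂ) + t * Complex.I) (by simp) ?_
    rw [h, sin_pi_mul_neg_nat]
  have hK := (tendsto_vertInt_cscKernel h0 h1).const_mul (2 * ((-1) ^ n * H (-(n : ℂ))))
  have := hlim.add hK
  rw [zero_add, mul_right_comm] at this
  refine this.congr fun p => ?_
  rw [hline n p, hline (n + 1) p]
  ring

lemma tendsto_vertInt_cscKernel_mul_sub_sum {H : ℂ → ℂ} (hH : Differentiable ℂ H) {c : ℝ}
    (h0 : 0 < c) (h1 : c < 1) (hd : ∀ a, DecaysOn (fun s => cscKernel s * H s) a c) (N : ℕ) :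
    Tendsto (fun p => vertInt (fun s => cscKernel s * H s) c p -
      vertInt (fun s => cscKernel s * H s) (c - N) p) (atTop ×ˢ atTop)
      (𝓝 (2 * Real.pi * ∑ n ∈ Finset.range N, (-1) ^ n * H (-(n : ℂ)))) := by
  induction N with
  | zero => simp
  | succ N ih =>
    rw [Finset.sum_range_succ, mul_add]
    have hN : (0 : ℝ) ≤ N := N.cast_nonneg
    have := ih.add (tendsto_vertInt_cscKernel_mul_sub hH h0 h1 N
      ((hd _).mono le_rfl (by linarith)))
    simpa using this

/-- Bounds under which the vertical integral of `π / sin (π s) * H s` can be moved to the left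
through all the poles `0, -1, -2, …`. -/
structure LeftShiftBounds (H : ℂ → ℂ) (c : ℝ) : Prop where
  differentiable : Differentiable ℂ H
  decays : ∀ a, ∃ η : ℝ → ℝ, Tendsto η atTop (𝓝 0) ∧ ∀ s : ℂ, a ≤ s.re → s.re ≤ c →
    1 ≤ |s.im| → ‖H s‖ ≤ Real.cosh (Real.pi * s.im) * η |s.im|
  left : ∃ (C U : ℝ) (g : ℝ → ℝ), MeasureTheory.Integrable g ∧ ∀ u t : ℝ, U ≤ u →
    ‖H (-u + t * Complex.I)‖ ≤ C * 2 ^ (-u) * (Real.cosh (Real.pi * t) * g t)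

lemma LeftShiftBounds.decaysOn {H : ℂ → ℂ} {c : ℝ} (h : LeftShiftBounds H c) (a : ℝ) :
    DecaysOn (fun s => cscKernel s * H s) a c := by
  obtain ⟨η, hη, hle⟩ := h.decays a
  refine ⟨fun t => 2 * Real.pi * η t, by simpa using hη.const_mul (2 * Real.pi),
    fun s h1 h2 h3 => ?_⟩
  have hc := Real.cosh_pos (Real.pi * s.im)
  rw [norm_mul]
  refine (mul_le_mul (norm_cscKernel_le h3) (hle s h1 h2 h3) (norm_nonneg _)
    (by have := Real.pi_pos; positivity)).trans_eq ?_
  field_simp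

lemma LeftShiftBounds.summable {H : ℂ → ℂ} {c : ℝ} (h : LeftShiftBounds H c) :
    Summable fun n : ℕ => (-1) ^ n * H (-(n : ℂ)) := by
  obtain ⟨C, U, g, -, hle⟩ := h.left
  have hg : Summable fun n : ℕ => C * g 0 * (1 / 2 : ℝ) ^ n :=
    (summable_geometric_of_lt_one (by norm_num) (by norm_num)).mul_left _
  refine Summable.of_norm_bounded_eventually_nat hg ?_
  filter_upwards [(tendsto_natCast_atTop_atTop (R := ℝ)).eventually_ge_atTop U] with n hn
  have := hle n 0 hn
  rw [norm_mul, norm_pow, norm_neg, norm_one, one_pow, one_mul]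
  simp only [Complex.ofReal_zero, zero_mul, add_zero, mul_zero, Real.cosh_zero, one_mul,
    Complex.ofReal_natCast, Real.rpow_neg zero_le_two, Real.rpow_natCast] at this
  refine this.trans_eq ?_
  rw [one_div, inv_pow]
  ring

/-- The lines `Re s = c - N` all keep the same distance from the poles, so `|sin (π s)| ≥ |sin (π
c)| cosh (π t)` holds uniformly in `N` and the remainder integral is `O(2^{-N})`. -/
lemma LeftShiftBounds.exists_line_bound {H : ℂ → ℂ} {c : ℝ} (h : LeftShiftBounds H c)
    (h0 : 0 < c) (h1 : c < 1) :
    ∃ (q : ℕ → ℂ) (N₀ : ℕ), Tendsto q atTop (𝓝 0) ∧ ∀ N ≥ N₀,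
      Tendsto (vertInt (fun s => cscKernel s * H s) (c - N)) (atTop ×ˢ atTop) (𝓝 (q N)) := by
  obtain ⟨C, U, g, hg, hle⟩ := h.left
  obtain ⟨N₀, hN₀⟩ := exists_nat_ge (U + c)
  set S := |Real.sin (Real.pi * c)| with hS
  have hS0 : 0 < S := by
    refine abs_pos.2 (Real.sin_pos_of_pos_of_lt_pi (by have := Real.pi_pos; positivity) ?_).ne'
    nlinarith [Real.pi_pos]
  have hbound : ∀ N ≥ N₀, ∀ t : ℝ,
      ‖cscKernel ((c - N : ℝ) + t * Complex.I) * H ((c - N : ℝ) + t * Complex.I)‖ ≤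
        (Real.pi * C / S * 2 ^ c * (1 / 2) ^ N) * g t := by
    intro N hN t
    have hNr : (N₀ : ℝ) ≤ N := by exact_mod_cast hN
    have h2 := hle (N - c) t (by linarith)
    have e1 : (-((N - c : ℝ) : ℂ) + t * Complex.I) = ((c - N : ℝ) : ℂ) + t * Complex.I := by
      push_cast
      ring
    have e2 : (2 : ℝ) ^ (-((N : ℝ) - c)) = 2 ^ c * (1 / 2) ^ N := by
      rw [neg_sub, sub_eq_add_neg, Real.rpow_add two_pos, Real.rpow_neg zero_le_two,
        Real.rpow_natCast, one_div, inv_pow]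
    rw [e1, e2] at h2
    have e3 : ‖cscKernel ((c - N : ℝ) + t * Complex.I)‖ ≤
        Real.pi / (S * Real.cosh (Real.pi * t)) := by
      have e4 : (((c - N : ℝ) : ℂ) + t * Complex.I) = (c + t * Complex.I) - N := by
        push_cast
        ring
      rw [e4, cscKernel_sub_nat, norm_mul, norm_pow, norm_neg, norm_one, one_pow, one_mul,
        cscKernel, norm_div, Complex.norm_real, Real.norm_of_nonneg Real.pi_pos.le]
      have := Real.cosh_pos (Real.pi * t)
      exact div_le_div_of_nonneg_left Real.pi_pos.le (by positivity) (abs_sin_mul_cosh_le c t)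
    have hch := Real.cosh_pos (Real.pi * t)
    rw [norm_mul]
    refine (mul_le_mul e3 h2 (norm_nonneg _)
      (by have := Real.pi_pos; positivity)).trans_eq ?_
    field_simp
  refine ⟨fun N => ∫ t : ℝ, cscKernel ((c - N : ℝ) + t * Complex.I) *
    H ((c - N : ℝ) + t * Complex.I), N₀, ?_, fun N hN => ?_⟩
  · have hlim : Tendsto (fun N : ℕ => (Real.pi * C / S * 2 ^ c * (1 / 2 : ℝ) ^ N) * ∫ t, g t)
        atTop (𝓝 0) := by
      have := ((tendsto_pow_atTop_nhds_zero_of_lt_one (by norm_num : (0 : ℝ) ≤ 1 / 2)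
        (by norm_num)).const_mul (Real.pi * C / S * 2 ^ c)).mul_const (∫ t, g t)
      simpa using this
    refine squeeze_zero_norm' ?_ hlim
    filter_upwards [eventually_ge_atTop N₀] with N hN
    rw [← MeasureTheory.integral_const_mul]
    exact MeasureTheory.norm_integral_le_of_norm_le (hg.const_mul _)
      (Eventually.of_forall (hbound N hN))
  · have hint : MeasureTheory.Integrable fun t : ℝ => cscKernel ((c - N : ℝ) + t * Complex.I) *
        H ((c - N : ℝ) + t * Complex.I) := by
      refine (hg.const_mul (Real.pi * C / S * 2 ^ c * (1 / 2) ^ N)).mono' ?_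
        (Eventually.of_forall (hbound N hN))
      exact ((continuous_cscKernel_line h0 h1 N).mul
        (h.differentiable.continuous.comp (by fun_prop))).aestronglyMeasurable
    exact MeasureTheory.intervalIntegral_tendsto_integral hint
      (tendsto_neg_atTop_atBot.comp tendsto_fst) tendsto_snd

lemma LeftShiftBounds.tendsto_vertInt {H : ℂ → ℂ} {c : ℝ} (h : LeftShiftBounds H c)
    (h0 : 0 < c) (h1 : c < 1) :
    Tendsto (vertInt (fun s => cscKernel s * H s) c) (atTop ×ˢ atTop)
      (𝓝 (2 * Real.pi * ∑' n : ℕ, (-1) ^ n * H (-(n : ℂ)))) := by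
  obtain ⟨q, N₀, hq, hN⟩ := h.exists_line_bound h0 h1
  have hlim : ∀ N ≥ N₀, Tendsto (vertInt (fun s => cscKernel s * H s) c) (atTop ×ˢ atTop)
      (𝓝 (2 * Real.pi * ∑ n ∈ Finset.range N, (-1) ^ n * H (-(n : ℂ)) + q N)) := by
    intro N hNN
    simpa using (tendsto_vertInt_cscKernel_mul_sub_sum h.differentiable h0 h1 h.decaysOn N).add
      (hN N hNN)
  have hsum := (h.summable.hasSum.tendsto_sum_nat.const_mul (2 * Real.pi : ℂ)).add hq
  rw [add_zero] at hsum
  -- For each `N ≥ N₀`, partial sum plus remainder is the limit of one and the same integral, hence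
  -- constant in `N`; letting `N → ∞` identifies it with the full series.
  have hconst : Tendsto (fun N => 2 * Real.pi * ∑ n ∈ Finset.range N, (-1) ^ n * H (-(n : ℂ)) +
      q N) atTop (𝓝 (2 * Real.pi * ∑ n ∈ Finset.range N₀, (-1) ^ n * H (-(n : ℂ)) + q N₀)) := by
    refine tendsto_const_nhds.congr' ?_
    filter_upwards [eventually_ge_atTop N₀] with N hNN
    exact tendsto_nhds_unique (hlim N₀ le_rfl) (hlim N hNN)
  rw [tendsto_nhds_unique hsum hconst]
  exact hlim N₀ le_rfl

/-! ### From limits of vertical integrals to Bromwich integrals -/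

lemma hasImproperBromwichIntegral_of_tendsto_vertInt {G : ℂ → ℂ} {c : ℝ} {w : ℂ}
    (h : Tendsto (vertInt G c) (atTop ×ˢ atTop) (𝓝 (2 * Real.pi * w))) :
    HasImproperBromwichIntegral c G w := by
  have h2 := h.const_mul (1 / (2 * Real.pi : ℂ))
  have hpi : (Real.pi : ℂ) ≠ 0 := Complex.ofReal_ne_zero.2 Real.pi_ne_zero
  rw [show 1 / (2 * Real.pi : ℂ) * (2 * Real.pi * w) = w by field_simp] at h2
  refine h2.congr fun p => ?_
  have e : ∀ X : ℂ, 1 / (2 * (Real.pi : ℂ)) * X =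
      1 / (2 * (Real.pi : ℂ) * Complex.I) * (X * Complex.I) := fun X => by
    have := Complex.I_ne_zero
    field_simp
  rw [intervalIntegral.integral_mul_const]
  exact e _

lemma HasImproperBromwichIntegral.hasBromwichIntegral {G : ℂ → ℂ} {c : ℝ} {w : ℂ}
    (h : HasImproperBromwichIntegral c G w)
    (hG : MeasureTheory.Integrable fun t : ℝ => G ((c : ℂ) + (t : ℂ) * Complex.I)) :
    HasBromwichIntegral c G w := by
  refine ⟨hG, tendsto_nhds_unique h (Tendsto.const_mul _ ?_)⟩
  exact MeasureTheory.intervalIntegral_tendsto_integral (hG.mul_const _)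
    (tendsto_neg_atTop_atBot.comp tendsto_fst) tendsto_snd

/-- The auxiliary line `c₀ < 1` allows `c ≥ 1`: there `π / sin (π s)` has poles, but `G` has none,
so `c₀` can be moved to `c` freely. -/
lemma LeftShiftBounds.hasImproperBromwichIntegral {G H : ℂ → ℂ} {c c₀ : ℝ}
    (h : LeftShiftBounds H c) (h0 : 0 < c₀) (h1 : c₀ < 1) (hcc : c₀ ≤ c)
    (hG : DifferentiableOn ℂ G {s | c₀ ≤ s.re ∧ s.re ≤ c})
    (hGH : ∀ s, Complex.sin (Real.pi * s) ≠ 0 → G s = cscKernel s * H s) :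
    HasImproperBromwichIntegral c G (∑' n : ℕ, (-1) ^ n * H (-(n : ℂ))) := by
  have hle : LeftShiftBounds H c₀ := ⟨h.differentiable, fun a => by
    obtain ⟨η, hη, hb⟩ := h.decays a
    exact ⟨η, hη, fun s h1 h2 => hb s h1 (h2.trans hcc)⟩, h.left⟩
  have hGd : DecaysOn G c₀ c := by
    obtain ⟨η, hη, hb⟩ := h.decaysOn c₀
    refine ⟨η, hη, fun s h1 h2 h3 => ?_⟩
    rw [hGH s fun hs => ?_]
    · exact hb s h1 h2 h3
    · have := cosh_le_two_mul_norm_sin s h3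
      rw [hs, norm_zero, mul_zero] at this
      linarith [Real.cosh_pos (Real.pi * s.im)]
  refine hasImproperBromwichIntegral_of_tendsto_vertInt ?_
  have hc₀ : vertInt G c₀ = vertInt (fun s => cscKernel s * H s) c₀ := by
    ext p
    simp only [vertInt]
    congr 1
    ext t
    exact hGH _ (sin_pi_mul_ne_zero_of_mem_Ioo (by simpa using h0) (by simpa using h1))
  have h2 := (hle.tendsto_vertInt h0 h1)
  rw [← hc₀] at h2
  simpa using (tendsto_vertInt_sub hcc hG hGd).add h2

lemma integrable_exp_neg_mul_abs {δ : ℝ} (hδ : 0 < δ) :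
    MeasureTheory.Integrable fun t : ℝ => Real.exp (-δ * |t|) := by
  rw [← MeasureTheory.integrableOn_univ, ← Set.Iic_union_Ioi (a := (0 : ℝ)),
    MeasureTheory.integrableOn_union]
  refine ⟨(integrableOn_exp_mul_Iic hδ 0).congr_fun (fun t ht => ?_) measurableSet_Iic,
    (integrableOn_exp_mul_Ioi (neg_lt_zero.2 hδ) 0).congr_fun (fun t ht => ?_) measurableSet_Ioi⟩
  · simp only
    rw [abs_of_nonpos ht, neg_mul_neg]
  · simp only
    rw [abs_of_pos ht]

lemma integrable_of_norm_le_on_complement {F : ℝ → ℂ} (hF : Continuous F) {g : ℝ → ℝ}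
    (hg : MeasureTheory.Integrable g) (h : ∀ t, 1 ≤ |t| → ‖F t‖ ≤ g t) :
    MeasureTheory.Integrable F := by
  refine hF.locallyIntegrable.integrable_of_isBigO_cocompact (g := g) ?_
    (hg.integrableAtFilter _)
  refine Asymptotics.IsBigO.of_bound 1 ?_
  filter_upwards [(isCompact_Icc (a := (-1 : ℝ)) (b := 1)).compl_mem_cocompact] with t ht
  rw [one_mul]
  refine (h t ?_).trans (le_abs_self _)
  by_contra hlt
  exact ht (abs_le.1 (not_le.1 hlt).le)

/-! ### Mellin transforms by Fourier inversion -/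

lemma mellinInv_eq_of_hasBromwichIntegral {G : ℂ → ℂ} {c x : ℝ} {w : ℂ}
    (h : HasBromwichIntegral c (fun s => G s * (x : ℂ) ^ (-s)) w) : mellinInv c G x = w := by
  have e : ∀ X : ℂ, 1 / (2 * (Real.pi : ℂ)) * X =
      1 / (2 * (Real.pi : ℂ) * Complex.I) * (X * Complex.I) := fun X => by
    have := Complex.I_ne_zero
    field_simp
  rw [h.2, MeasureTheory.integral_mul_const, ← e, mellinInv, Complex.real_smul]
  simp only [smul_eq_mul, mul_comm (G _)]
  push_cast
  rfl

lemma integrable_of_hasBromwichIntegral {G : ℂ → ℂ} {c : ℝ} {w : ℂ}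
    (h : HasBromwichIntegral c (fun s => G s * ((1 : ℝ) : ℂ) ^ (-s)) w) :
    MeasureTheory.Integrable fun t : ℝ => G (c + t * Complex.I) := by
  simpa using h.1

lemma exists_norm_le_rpow_of_hasBromwichIntegral {f : ℝ → ℂ} {G : ℂ → ℂ} {c : ℝ}
    (h : ∀ x : ℝ, 0 < x → HasBromwichIntegral c (fun s => G s * (x : ℂ) ^ (-s)) (f x)) :
    ∃ C : ℝ, ∀ x : ℝ, 0 < x → ‖f x‖ ≤ C * x ^ (-c) := by
  refine ⟨1 / (2 * Real.pi) * ∫ t : ℝ, ‖G (c + t * Complex.I)‖, fun x hx => ?_⟩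
  rw [← mellinInv_eq_of_hasBromwichIntegral (h x hx), mellinInv, norm_smul, mul_assoc]
  have hpi := Real.pi_pos
  rw [Real.norm_of_nonneg (by positivity)]
  refine mul_le_mul_of_nonneg_left ?_ (by positivity)
  rw [← MeasureTheory.integral_mul_const]
  refine (MeasureTheory.norm_integral_le_integral_norm _).trans_eq ?_
  congr 1
  ext t
  rw [norm_smul, Complex.norm_cpow_eq_rpow_re_of_pos hx, mul_comm]
  simp

lemma continuousOn_of_hasBromwichIntegral {f : ℝ → ℂ} {G : ℂ → ℂ} {c : ℝ}
    (h : ∀ x : ℝ, 0 < x → HasBromwichIntegral c (fun s => G s * (x : ℂ) ^ (-s)) (f x)) :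
    ContinuousOn f (Set.Ioi 0) := by
  have hint := integrable_of_hasBromwichIntegral (h 1 one_pos)
  have hint' : MeasureTheory.Integrable fun y : ℝ => G (c + 2 * Real.pi * y * Complex.I) := by
    have := hint.comp_mul_left' (R := 2 * Real.pi) (by have := Real.pi_pos; positivity)
    simpa using this
  have hcont : Continuous (𝓕⁻ fun y : ℝ => G (c + 2 * Real.pi * y * Complex.I)) := by
    exact VectorFourier.fourierIntegral_continuous Real.continuous_fourierChar
      (by fun_prop) hint'
  have h2 : ContinuousOn (fun x : ℝ => (x : ℂ) ^ (-c : ℂ) •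
      𝓕⁻ (fun y : ℝ => G (c + 2 * Real.pi * y * Complex.I)) (-Real.log x)) (Set.Ioi 0) := by
    intro x hx
    have hx' : (0 : ℝ) < x := hx
    refine ContinuousAt.continuousWithinAt (ContinuousAt.fun_smul ?_ ?_)
    · exact (continuousAt_cpow_const (by simpa using hx')).comp
        Complex.continuous_ofReal.continuousAt
    · exact hcont.continuousAt.comp (Real.continuousAt_log hx'.ne').neg
  refine h2.congr fun x hx => ?_
  simp only
  rw [← mellinInv_eq_fourierInv c G hx, mellinInv_eq_of_hasBromwichIntegral (h x hx)]

/-- A function that is given by absolutely convergent inverse Mellin integrals on all vertical lines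
of an open strip has a Mellin transform there, which is the function integrated. -/
lemma hasMellin_of_hasBromwichIntegral {f : ℝ → ℂ} {G : ℂ → ℂ} {a b : ℝ}
    (h : ∀ c : ℝ, a < c → c < b → ∀ x : ℝ, 0 < x →
      HasBromwichIntegral c (fun s => G s * (x : ℂ) ^ (-s)) (f x))
    {s : ℂ} (ha : a < s.re) (hb : s.re < b)
    (hG : Continuous fun t : ℝ => G (s.re + t * Complex.I)) : HasMellin f s (G s) := by
  have hbig : ∀ c : ℝ, a < c → c < b → ∀ l : Filter ℝ, (∀ᶠ x in l, 0 < x) →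
      f =O[l] fun x => x ^ (-c) := by
    intro c hc1 hc2 l hl
    obtain ⟨C, hC⟩ := exists_norm_le_rpow_of_hasBromwichIntegral (h c hc1 hc2)
    refine Asymptotics.IsBigO.of_bound C ?_
    filter_upwards [hl] with x hx
    rw [Real.norm_of_nonneg (by positivity)]
    exact hC x hx
  have hconv : MellinConvergent f s := by
    refine mellinConvergent_of_isBigO_rpow (a := (s.re + b) / 2) (b := (a + s.re) / 2)
      ((continuousOn_of_hasBromwichIntegral (h s.re ha hb)).locallyIntegrableOn measurableSet_Ioi)
      (hbig _ (by linarith) (by linarith) _ (eventually_gt_atTop 0)) (by linarith)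
      (hbig _ (by linarith) (by linarith) _ ?_) (by linarith)
    filter_upwards [self_mem_nhdsWithin] with x hx using hx
  refine ⟨hconv, ?_⟩
  set σ := s.re with hσ
  set g : ℝ → ℂ := fun y => G (σ + 2 * Real.pi * y * Complex.I) with hg
  have hg_cont : Continuous g := by
    have := hG.comp (continuous_const.mul continuous_id : Continuous fun y : ℝ => 2 * Real.pi * y)
    refine this.congr fun y => ?_
    simp [hg]
  have hg_int : MeasureTheory.Integrable g := by
    have := (integrable_of_hasBromwichIntegral (h σ ha hb 1 one_pos)).comp_mul_left'
      (R := 2 * Real.pi) (by have := Real.pi_pos; positivity)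
    simpa [hg] using this
  have hfg : ∀ u : ℝ, Real.exp (-σ * u) • f (Real.exp (-u)) = 𝓕⁻ g u := by
    intro u
    rw [← mellinInv_eq_of_hasBromwichIntegral (h σ ha hb _ (Real.exp_pos (-u))),
      mellinInv_eq_fourierInv _ _ (Real.exp_pos _), Real.log_exp, neg_neg, smul_eq_mul,
      Complex.real_smul, ← mul_assoc]
    have : ((Real.exp (-σ * u) : ℝ) : ℂ) * ((Real.exp (-u) : ℝ) : ℂ) ^ (-σ : ℂ) = 1 := by
      rw [← Complex.ofReal_neg, ← Complex.ofReal_cpow (Real.exp_pos _).le, ← Complex.ofReal_mul,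
        ← Real.exp_mul, ← Real.exp_add, show -σ * u + -u * -σ = 0 by ring, Real.exp_zero,
        Complex.ofReal_one]
    rw [this, one_mul]
  -- The lines halfway from `σ` to `a` and to `b` give exponential decay as `u → +∞` and `u → -∞`
  -- respectively.
  have hF_int : MeasureTheory.Integrable (𝓕⁻ g) := by
    obtain ⟨C₁, hC₁⟩ := exists_norm_le_rpow_of_hasBromwichIntegral
      (h ((a + σ) / 2) (by linarith) (by linarith))
    obtain ⟨C₂, hC₂⟩ := exists_norm_le_rpow_of_hasBromwichIntegral
      (h ((σ + b) / 2) (by linarith) (by linarith))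
    have hcont : Continuous (𝓕⁻ g) :=
      VectorFourier.fourierIntegral_continuous Real.continuous_fourierChar (by fun_prop) hg_int
    have hnorm : ∀ u c C : ℝ, ‖f (Real.exp (-u))‖ ≤ C * Real.exp (-u) ^ (-c) →
        ‖𝓕⁻ g u‖ ≤ C * Real.exp ((c - σ) * u) := by
      intro u c C hu
      rw [← hfg, norm_smul, Real.norm_of_nonneg (Real.exp_pos _).le]
      refine (mul_le_mul_of_nonneg_left hu (Real.exp_pos _).le).trans_eq ?_
      rw [← Real.exp_mul, mul_left_comm, ← Real.exp_add]
      ring_nf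
    refine integrable_of_norm_le_on_complement hcont
      (g := fun u => (|C₁| + |C₂|) * Real.exp (-(min (σ - a) (b - σ) / 2) * |u|))
      ((integrable_exp_neg_mul_abs (by
        have := lt_min (sub_pos.2 ha) (sub_pos.2 hb)
        positivity)).const_mul _) fun u _ => ?_
    rcases le_total 0 u with hu | hu
    · refine (hnorm u _ C₁ (hC₁ _ (Real.exp_pos _))).trans ?_
      rw [abs_of_nonneg hu]
      refine mul_le_mul ((le_abs_self _).trans (le_add_of_nonneg_right (abs_nonneg _)))
        (Real.exp_le_exp.2 (mul_le_mul_of_nonneg_right ?_ hu)) (Real.exp_pos _).le (by positivity)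
      linarith [min_le_left (σ - a) (b - σ)]
    · refine (hnorm u _ C₂ (hC₂ _ (Real.exp_pos _))).trans ?_
      rw [abs_of_nonpos hu, neg_mul_neg]
      refine mul_le_mul ((le_abs_self _).trans (le_add_of_nonneg_left (abs_nonneg _)))
        (Real.exp_le_exp.2 (mul_le_mul_of_nonpos_right ?_ hu)) (Real.exp_pos _).le (by positivity)
      linarith [min_le_right (σ - a) (b - σ)]
  have hF_int' : MeasureTheory.Integrable (𝓕 g) := by
    refine hF_int.comp_neg.congr (Eventually.of_forall fun u => ?_)
    simp [Real.fourierInv_eq_fourier_neg]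
  rw [mellin_eq_fourier]
  have e1 : (fun u : ℝ => Real.exp (-s.re * u) • f (Real.exp (-u))) = 𝓕⁻ g := funext hfg
  rw [e1, hg_cont.fourier_fourierInv_eq hg_int hF_int', hg]
  have hpi : (Real.pi : ℂ) ≠ 0 := Complex.ofReal_ne_zero.2 Real.pi_ne_zero
  simp only
  congr 1
  conv_rhs => rw [← Complex.re_add_im s]
  push_cast
  field_simp
  rw [hσ]

/-! ### Exponential growth of rate below `π` -/

lemma exp_pi_mul_abs_le (t : ℝ) : Real.exp (Real.pi * |t|) ≤ 2 * Real.cosh (Real.pi * t) := by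
  have := Real.exp_abs_le_two_mul_cosh (Real.pi * t)
  rwa [abs_mul, abs_of_pos Real.pi_pos] at this

lemma exp_mul_abs_le_cosh_mul (θ t : ℝ) :
    Real.exp (θ * |t|) ≤ Real.cosh (Real.pi * t) * (2 * Real.exp (-(Real.pi - θ) * |t|)) := by
  have e : Real.exp (θ * |t|) = Real.exp (Real.pi * |t|) * Real.exp (-(Real.pi - θ) * |t|) := by
    rw [← Real.exp_add]
    ring_nf
  rw [e]
  nlinarith [exp_pi_mul_abs_le t, Real.exp_pos (-(Real.pi - θ) * |t|)]

lemma LeftShiftBounds.of_exp {H : ℂ → ℂ} {c θ : ℝ} (hH : Differentiable ℂ H) (hθ : θ < Real.pi)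
    (h1 : ∀ a, ∃ C : ℝ, ∀ s : ℂ, a ≤ s.re → s.re ≤ c → ‖H s‖ ≤ C * Real.exp (θ * |s.im|))
    (h2 : ∃ C U : ℝ, ∀ u t : ℝ, U ≤ u →
      ‖H (-u + t * Complex.I)‖ ≤ C * 2 ^ (-u) * Real.exp (θ * |t|)) :
    LeftShiftBounds H c := by
  refine ⟨hH, fun a => ?_, ?_⟩
  · obtain ⟨C, hC⟩ := h1 a
    refine ⟨fun t => |C| * (2 * Real.exp (-(Real.pi - θ) * t)), ?_, fun s hs1 hs2 _ => ?_⟩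
    · have : Tendsto (fun t => -(Real.pi - θ) * t) atTop atBot :=
        tendsto_id.const_mul_atTop_of_neg (by linarith)
      simpa using ((Real.tendsto_exp_atBot.comp this).const_mul 2).const_mul |C|
    · refine (hC s hs1 hs2).trans ?_
      rw [mul_left_comm]
      exact mul_le_mul (le_abs_self C) (exp_mul_abs_le_cosh_mul _ _) (Real.exp_pos _).le
        (abs_nonneg C)
  · obtain ⟨C, U, hC⟩ := h2
    refine ⟨|C|, U, fun t => 2 * Real.exp (-(Real.pi - θ) * |t|),
      (integrable_exp_neg_mul_abs (by linarith)).const_mul _, fun u t hu => ?_⟩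
    refine (hC u t hu).trans ?_
    refine mul_le_mul (mul_le_mul_of_nonneg_right (le_abs_self C) (by positivity))
      (exp_mul_abs_le_cosh_mul _ _) (Real.exp_pos _).le (by positivity)

lemma continuous_line_of_differentiableOn {G : ℂ → ℂ} {c₀ c : ℝ} (hcc : c₀ ≤ c)
    (hG : DifferentiableOn ℂ G {s | c₀ ≤ s.re ∧ s.re ≤ c}) :
    Continuous fun t : ℝ => G (c + t * Complex.I) :=
  hG.continuousOn.comp_continuous (by fun_prop) fun t => by simpa using hcc

lemma integrable_line_of_le {G H : ℂ → ℂ} {c₀ c : ℝ} (hcc : c₀ ≤ c)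
    (hG : DifferentiableOn ℂ G {s | c₀ ≤ s.re ∧ s.re ≤ c})
    (hGH : ∀ s, Complex.sin (Real.pi * s) ≠ 0 → G s = cscKernel s * H s) {g : ℝ → ℝ}
    (hg : MeasureTheory.Integrable g)
    (hH : ∀ t : ℝ, ‖H (c + t * Complex.I)‖ ≤ Real.cosh (Real.pi * t) * g t) :
    MeasureTheory.Integrable fun t : ℝ => G (c + t * Complex.I) := by
  refine integrable_of_norm_le_on_complement (continuous_line_of_differentiableOn hcc hG)
    (hg.const_mul (2 * Real.pi)) fun t ht => ?_
  have him : ((c : ℂ) + t * Complex.I).im = t := by simp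
  have hch := Real.cosh_pos (Real.pi * t)
  rw [hGH _ fun hs => ?_, norm_mul]
  · have hk := norm_cscKernel_le (s := (c : ℂ) + t * Complex.I) (by rwa [him])
    rw [him] at hk
    refine (mul_le_mul hk (hH t) (norm_nonneg _)
      (by have := Real.pi_pos; positivity)).trans_eq ?_
    field_simp
  · have := cosh_le_two_mul_norm_sin ((c : ℂ) + t * Complex.I) (by rwa [him])
    rw [hs, norm_zero, mul_zero, him] at this
    linarith

lemma hasBromwichIntegral_of_exp {G H : ℂ → ℂ} {c c₀ θ : ℝ} (h0 : 0 < c₀) (h1 : c₀ < 1)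
    (hcc : c₀ ≤ c) (hG : DifferentiableOn ℂ G {s | c₀ ≤ s.re ∧ s.re ≤ c})
    (hGH : ∀ s, Complex.sin (Real.pi * s) ≠ 0 → G s = cscKernel s * H s)
    (hH : Differentiable ℂ H) (hθ : θ < Real.pi)
    (hstrip : ∀ a, ∃ C : ℝ, ∀ s : ℂ, a ≤ s.re → s.re ≤ c → ‖H s‖ ≤ C * Real.exp (θ * |s.im|))
    (hleft : ∃ C U : ℝ, ∀ u t : ℝ, U ≤ u →
      ‖H (-u + t * Complex.I)‖ ≤ C * 2 ^ (-u) * Real.exp (θ * |t|)) :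
    HasBromwichIntegral c G (∑' n : ℕ, (-1) ^ n * H (-(n : ℂ))) := by
  refine ((LeftShiftBounds.of_exp hH hθ hstrip hleft).hasImproperBromwichIntegral h0 h1 hcc hG
    hGH).hasBromwichIntegral ?_
  obtain ⟨C, hC⟩ := hstrip c
  refine integrable_line_of_le hcc hG hGH (g := fun t =>
    |C| * (2 * Real.exp (-(Real.pi - θ) * |t|)))
    (((integrable_exp_neg_mul_abs (by linarith)).const_mul _).const_mul _) fun t => ?_
  refine (hC _ (by simp) (by simp)).trans ?_
  rw [mul_left_comm]
  simp only [Complex.add_im, Complex.ofReal_im, Complex.mul_im, Complex.ofReal_re, Complex.I_im,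
    mul_one, Complex.I_re, mul_zero, add_zero, zero_add]
  exact mul_le_mul (le_abs_self C) (exp_mul_abs_le_cosh_mul _ _) (Real.exp_pos _).le
    (abs_nonneg C)

/-! ### The Mittag-Leffler kernel -/

lemma rpow_neg_le_add {z a c σ : ℝ} (hz : 0 < z) (ha : a ≤ σ) (hc : σ ≤ c) :
    z ^ (-σ) ≤ z ^ (-a) + z ^ (-c) := by
  have h1 := Real.rpow_pos_of_pos hz (-a)
  have h2 := Real.rpow_pos_of_pos hz (-c)
  rcases le_total 1 z with h | h
  · exact (Real.rpow_le_rpow_of_exponent_le h (neg_le_neg ha)).trans (by linarith)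
  · exact (Real.rpow_le_rpow_of_exponent_ge hz h (neg_le_neg hc)).trans (by linarith)

lemma norm_ofReal_cpow_neg {z : ℝ} (hz : 0 < z) (s : ℂ) : ‖(z : ℂ) ^ (-s)‖ = z ^ (-s.re) := by
  rw [Complex.norm_cpow_eq_rpow_re_of_pos hz, Complex.neg_re]

/-- The entire function `z^{-s} / Γ(b - β s)`. -/
noncomputable def mittagLefflerKernel (β b z : ℝ) (s : ℂ) : ℂ :=
  (z : ℂ) ^ (-s) * (Complex.Gamma ((b : ℂ) - (β : ℂ) * s))⁻¹

lemma differentiable_mittagLefflerKernel {β b z : ℝ} (hz : 0 < z) :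
    Differentiable ℂ (mittagLefflerKernel β b z) := by
  have hz' : (z : ℂ) ≠ 0 := by exact_mod_cast hz.ne'
  refine Differentiable.mul (fun s => ?_) ?_
  · exact DifferentiableAt.const_cpow (by fun_prop) (Or.inl hz')
  · exact Complex.differentiable_one_div_Gamma.comp (by fun_prop)

lemma tsum_mittagLefflerKernel {β b z : ℝ} :
    ∑' n : ℕ, (-1) ^ n * mittagLefflerKernel β b z (-(n : ℂ)) =
      mittagLeffler β b (-(z : ℂ)) := by
  refine tsum_congr fun n => ?_
  rw [mittagLefflerKernel, neg_neg, Complex.cpow_natCast, neg_pow (z : ℂ), div_eq_mul_inv,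
    mul_assoc]
  ring_nf

lemma Gamma_mul_Gamma_div_eq (β b z : ℝ) (s : ℂ) :
    Complex.Gamma s * Complex.Gamma (1 - s) / Complex.Gamma ((b : ℂ) - (β : ℂ) * s) *
      (z : ℂ) ^ (-s) = cscKernel s * mittagLefflerKernel β b z s := by
  rw [Complex.Gamma_mul_Gamma_one_sub, cscKernel, mittagLefflerKernel]
  ring

lemma differentiableAt_Gamma_mul_Gamma_div (β b : ℝ) {s : ℂ} (h0 : 0 < s.re) (h1 : s.re < 1) :
    DifferentiableAt ℂ (fun s => Complex.Gamma s * Complex.Gamma (1 - s) /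
      Complex.Gamma ((b : ℂ) - (β : ℂ) * s)) s := by
  have d1 : DifferentiableAt ℂ cscKernel s :=
    differentiableAt_cscKernel (sin_pi_mul_ne_zero_of_mem_Ioo h0 h1)
  have d2 : Differentiable ℂ fun s : ℂ => (Complex.Gamma ((b : ℂ) - (β : ℂ) * s))⁻¹ :=
    Complex.differentiable_one_div_Gamma.comp (by fun_prop)
  refine (d1.mul (d2 s)).congr_of_eventuallyEq (Eventually.of_forall fun w => ?_)
  simp only [Pi.mul_apply, cscKernel]
  rw [Complex.Gamma_mul_Gamma_one_sub, div_eq_mul_inv]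

lemma differentiableOn_cscKernel_mul_mittagLefflerKernel {β b z c : ℝ} (hz : 0 < z) (h0 : 0 < c)
    (h1 : c < 1) : DifferentiableOn ℂ (fun s => Complex.Gamma s * Complex.Gamma (1 - s) /
      Complex.Gamma ((b : ℂ) - (β : ℂ) * s) * (z : ℂ) ^ (-s)) {s | c ≤ s.re ∧ s.re ≤ c} := by
  intro s hs
  have hz' : (z : ℂ) ≠ 0 := by exact_mod_cast hz.ne'
  refine ((differentiableAt_Gamma_mul_Gamma_div β b (h0.trans_le hs.1)
    (hs.2.trans_lt h1)).mul ?_).differentiableWithinAt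
  exact DifferentiableAt.const_cpow (by fun_prop) (Or.inl hz')

lemma exists_rpow_div_Gamma_add_le {z β b : ℝ} (hz : 0 < z) (hβ : 0 < β) (hb : 0 ≤ b) :
    ∃ C : ℝ, ∀ u : ℝ, 2 ≤ β * u → z ^ u / Real.Gamma (b + β * u) ≤ C * 2 ^ (-u) := by
  obtain ⟨C, -, hC⟩ := exists_rpow_div_Gamma_le hz hβ
  refine ⟨C, fun u hu => le_trans ?_ (hC u (by linarith))⟩
  have := Real.Gamma_pos_of_pos (by linarith : 0 < β * u)
  refine div_le_div_of_nonneg_left (by positivity) this ?_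
  exact Real.Gamma_strictMonoOn_Ici.monotoneOn (Set.mem_Ici.2 hu) (Set.mem_Ici.2 (by linarith))
    (by linarith)

lemma norm_mittagLefflerKernel_left {β b z : ℝ} (hz : 0 < z) (u t : ℝ) :
    ‖mittagLefflerKernel β b z (-u + t * Complex.I)‖ = z ^ u *
      ‖(Complex.Gamma ((b + β * u : ℝ) + (-(β * t) : ℝ) * Complex.I))⁻¹‖ := by
  rw [mittagLefflerKernel, norm_mul, norm_ofReal_cpow_neg hz]
  congr 3
  · simp
  · congr 1
    push_cast
    ring

lemma hasBromwichIntegral_mittagLeffler {β b c z : ℝ} (h0 : 0 < β) (h2 : β < 2) (hb : 0 ≤ b)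
    (hc0 : 0 < c) (hc1 : c < 1) (hz : 0 < z) :
    HasBromwichIntegral c (fun s => Complex.Gamma s * Complex.Gamma (1 - s) /
      Complex.Gamma ((b : ℂ) - (β : ℂ) * s) * (z : ℂ) ^ (-s)) (mittagLeffler β b (-(z : ℂ))) := by
  have hpi := Real.pi_pos
  -- Small enough that the rate `(π/2 + ε) β` stays below `π`.
  set ε := Real.pi * (2 - β) / 8 with hε
  have hε0 : 0 < ε := by
    have : 0 < 2 - β := by linarith
    positivity
  rw [← tsum_mittagLefflerKernel]
  refine hasBromwichIntegral_of_exp (θ := (Real.pi / 2 + ε) * β) hc0 hc1 le_rfl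
    (differentiableOn_cscKernel_mul_mittagLefflerKernel hz hc0 hc1)
    (fun s _ => Gamma_mul_Gamma_div_eq β b z s) (differentiable_mittagLefflerKernel hz) ?_ ?_ ?_
  · rw [hε]
    nlinarith [mul_pos hpi h0, mul_pos hpi (sub_pos.2 h2)]
  · intro a
    obtain ⟨C, hC, hle⟩ := exists_norm_inv_Gamma_le_strip hε0 (b - β * c) (b - β * a)
    refine ⟨(z ^ (-a) + z ^ (-c)) * C, fun s hs1 hs2 => ?_⟩
    have h := hle ((b : ℂ) - (β : ℂ) * s) (by simp; nlinarith) (by simp; nlinarith)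
    rw [mittagLefflerKernel, norm_mul, norm_ofReal_cpow_neg hz, mul_assoc]
    refine mul_le_mul (rpow_neg_le_add hz hs1 hs2) (h.trans_eq ?_) (norm_nonneg _)
      (by positivity)
    simp [abs_mul, abs_of_pos h0, mul_assoc]
  · obtain ⟨C, hC⟩ := exists_rpow_div_Gamma_add_le hz h0 hb
    refine ⟨C, 2 / β, fun u t hu => ?_⟩
    have hu' : 2 ≤ β * u := by rwa [div_le_iff₀' h0] at hu
    rw [norm_mittagLefflerKernel_left hz]
    have h := norm_inv_Gamma_le (x := b + β * u) (by linarith) (-(β * t))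
    have hG := Real.Gamma_pos_of_pos (by linarith : 0 < b + β * u)
    calc _ ≤ z ^ u * (Real.exp (Real.pi / 2 * |-(β * t)|) / Real.Gamma (b + β * u)) := by gcongr
      _ = z ^ u / Real.Gamma (b + β * u) * Real.exp (Real.pi / 2 * β * |t|) := by
        rw [abs_neg, abs_mul, abs_of_pos h0]
        ring_nf
      _ ≤ C * 2 ^ (-u) * Real.exp ((Real.pi / 2 + ε) * β * |t|) := by
        have h3 := hC u hu'
        have h4 : 0 ≤ z ^ u / Real.Gamma (b + β * u) := by positivity
        refine mul_le_mul h3 (Real.exp_le_exp.2 ?_) (Real.exp_pos _).le (h4.trans h3)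
        linarith [mul_nonneg (mul_nonneg hε0.le h0.le) (abs_nonneg t)]

/-- Here `1 / Γ(b - 2s)` has the full rate `π`, so only powers of `|t|` help: some negative power on
the strip, since `b - 2 Re s > 1/2`, and the integrable `1 / (1 + t²)` far to the left. -/
lemma leftShiftBounds_mittagLefflerKernel_two {b c z : ℝ} (hb : 0 ≤ b) (hbc : 1 / 2 < b - 2 * c)
    (hz : 0 < z) : LeftShiftBounds (mittagLefflerKernel 2 b z) c := by
  refine ⟨differentiable_mittagLefflerKernel hz, fun a => ?_, ?_⟩
  · set θ := min 1 (b - 2 * c - 1 / 2) with hθ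
    have hθ0 : 0 < θ := lt_min one_pos (by linarith)
    set K := 2 * ((z ^ (-a) + z ^ (-c)) * Real.exp 2) with hK
    refine ⟨fun t => K * (1 + t ^ 2) ^ (-(θ / 2)), ?_, fun s hs1 hs2 _ => ?_⟩
    · have h1 : Tendsto (fun t : ℝ => 1 + t ^ 2) atTop atTop :=
        tendsto_atTop_add_const_left _ _ (tendsto_pow_atTop two_ne_zero)
      simpa using ((tendsto_rpow_neg_atTop (half_pos hθ0)).comp h1).const_mul K
    · have h := norm_inv_Gamma_le_rpow hθ0.le (min_le_left _ _)
        (x := b - 2 * s.re) (by linarith [min_le_right 1 (b - 2 * c - 1 / 2)]) (-(2 * s.im))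
      have hG := exp_neg_two_le_Gamma (x := b - 2 * s.re) (by linarith)
      have e : (((b - 2 * s.re : ℝ) : ℂ) + ((-(2 * s.im) : ℝ) : ℂ) * Complex.I) =
          (b : ℂ) - ((2 : ℝ) : ℂ) * s := by
        apply Complex.ext <;> simp
      rw [e] at h
      rw [mittagLefflerKernel, norm_mul, norm_ofReal_cpow_neg hz]
      have h3 : (1 + (-(2 * s.im)) ^ 2) ^ (-θ / 2) ≤ (1 + |s.im| ^ 2) ^ (-(θ / 2)) := by
        rw [neg_div]
        refine Real.rpow_le_rpow_of_nonpos (by positivity) ?_ (by linarith)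
        rw [sq_abs]
        nlinarith [sq_nonneg s.im]
      have h4 : Real.exp (Real.pi / 2 * |-(2 * s.im)|) ≤ 2 * Real.cosh (Real.pi * s.im) := by
        refine le_trans (le_of_eq ?_) (exp_pi_mul_abs_le s.im)
        rw [abs_neg, abs_mul, abs_two]
        ring_nf
      have hch := Real.cosh_pos (Real.pi * s.im)
      calc _ ≤ (z ^ (-a) + z ^ (-c)) * (2 * Real.cosh (Real.pi * s.im) *
            (1 + |s.im| ^ 2) ^ (-(θ / 2)) / Real.exp (-2)) := by
            refine mul_le_mul (rpow_neg_le_add hz hs1 hs2) (h.trans ?_) (norm_nonneg _)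
              (by positivity)
            gcongr
        _ = _ := by
            rw [Real.exp_neg, div_inv_eq_mul, hK]
            ring
  · obtain ⟨C, hC⟩ := exists_rpow_div_Gamma_add_le hz two_pos hb
    -- `u ≥ 5/4` gives `b + 2u ≥ 5/2 = 3/2 + 1`, as the bound with `θ = 1` requires.
    refine ⟨C, 5 / 4, fun t => 3 * (1 + t ^ 2)⁻¹, integrable_inv_one_add_sq.const_mul _,
      fun u t hu => ?_⟩
    rw [norm_mittagLefflerKernel_left hz]
    have h := norm_inv_Gamma_le_rpow_add_one zero_le_one le_rfl (x := b + 2 * u) (by linarith)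
      (-(2 * t))
    have hG := Real.Gamma_pos_of_pos (by linarith : 0 < b + 2 * u)
    have h3 : (1 + (-(2 * t)) ^ 2) ^ (-(1 + 1 : ℝ) / 2) ≤ (1 + t ^ 2)⁻¹ := by
      rw [show (-(1 + 1 : ℝ) / 2) = -1 by norm_num, Real.rpow_neg_one]
      refine inv_anti₀ (by positivity) ?_
      nlinarith [sq_nonneg t]
    have h4 : Real.exp (Real.pi / 2 * |-(2 * t)|) ≤ 2 * Real.cosh (Real.pi * t) := by
      refine le_trans (le_of_eq ?_) (exp_pi_mul_abs_le t)
      rw [abs_neg, abs_mul, abs_two]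
      ring_nf
    have hch := Real.cosh_pos (Real.pi * t)
    calc _ ≤ z ^ u * (3 / 2 * (2 * Real.cosh (Real.pi * t)) * (1 + t ^ 2)⁻¹ /
          Real.Gamma (b + 2 * u)) := by
          refine mul_le_mul_of_nonneg_left (h.trans ?_) (by positivity)
          gcongr
      _ = z ^ u / Real.Gamma (b + 2 * u) * (Real.cosh (Real.pi * t) * (3 * (1 + t ^ 2)⁻¹)) := by
          ring
      _ ≤ _ := by
          have := hC u (by linarith)
          gcongr

lemma hasImproperBromwichIntegral_mittagLeffler_two {b c z : ℝ} (hb : 0 ≤ b)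
    (hbc : 1 / 2 < b - 2 * c) (hc0 : 0 < c) (hc1 : c < 1) (hz : 0 < z) :
    HasImproperBromwichIntegral c (fun s => Complex.Gamma s * Complex.Gamma (1 - s) /
      Complex.Gamma ((b : ℂ) - ((2 : ℝ) : ℂ) * s) * (z : ℂ) ^ (-s))
      (mittagLeffler 2 b (-(z : ℂ))) := by
  rw [← tsum_mittagLefflerKernel]
  exact (leftShiftBounds_mittagLefflerKernel_two hb hbc hz).hasImproperBromwichIntegral hc0 hc1
    le_rfl (differentiableOn_cscKernel_mul_mittagLefflerKernel hz hc0 hc1)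
    (fun s _ => Gamma_mul_Gamma_div_eq 2 b z s)

/-- One more unit of `b - 2c` raises the decay to a power of `|t|` with exponent `1 + θ > 1`, which
is integrable. -/
lemma hasBromwichIntegral_mittagLeffler_two {b c z : ℝ} (hb : 0 ≤ b)
    (hbc : 3 / 2 < b - 2 * c) (hc0 : 0 < c) (hc1 : c < 1) (hz : 0 < z) :
    HasBromwichIntegral c (fun s => Complex.Gamma s * Complex.Gamma (1 - s) /
      Complex.Gamma ((b : ℂ) - ((2 : ℝ) : ℂ) * s) * (z : ℂ) ^ (-s))
      (mittagLeffler 2 b (-(z : ℂ))) := by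
  refine (hasImproperBromwichIntegral_mittagLeffler_two hb (by linarith) hc0 hc1
    hz).hasBromwichIntegral ?_
  set θ := min 1 (b - 2 * c - 3 / 2) with hθ
  have hθ0 : 0 < θ := lt_min one_pos (by linarith)
  have hG := Real.Gamma_pos_of_pos (by linarith : 0 < b - 2 * c)
  have hint : MeasureTheory.Integrable fun t : ℝ => (1 + t ^ 2) ^ (-(1 + θ) / 2) := by
    have := integrable_rpow_neg_one_add_norm_sq (E := ℝ) (μ := MeasureTheory.volume)
      (r := 1 + θ) (by simpa using hθ0)
    simpa using this
  refine integrable_line_of_le le_rfl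
    (differentiableOn_cscKernel_mul_mittagLefflerKernel hz hc0 hc1)
    (fun s _ => Gamma_mul_Gamma_div_eq 2 b z s)
    (hint.const_mul (z ^ (-c) * 3 / Real.Gamma (b - 2 * c))) fun t => ?_
  have e : (c : ℂ) + t * Complex.I = -((-c : ℝ) : ℂ) + t * Complex.I := by push_cast; ring
  rw [e, norm_mittagLefflerKernel_left hz, show b + 2 * -c = b - 2 * c by ring]
  have h := norm_inv_Gamma_le_rpow_add_one hθ0.le (min_le_left _ _) (x := b - 2 * c)
    (by linarith [min_le_right 1 (b - 2 * c - 3 / 2)]) (-(2 * t))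
  have h3 : (1 + (-(2 * t)) ^ 2) ^ (-(1 + θ) / 2) ≤ (1 + t ^ 2) ^ (-(1 + θ) / 2) := by
    refine Real.rpow_le_rpow_of_nonpos (by positivity) ?_ (by linarith)
    nlinarith [sq_nonneg t]
  have h4 : Real.exp (Real.pi / 2 * |-(2 * t)|) ≤ 2 * Real.cosh (Real.pi * t) := by
    refine le_trans (le_of_eq ?_) (exp_pi_mul_abs_le t)
    rw [abs_neg, abs_mul, abs_two]
    ring_nf
  have hch := Real.cosh_pos (Real.pi * t)
  calc _ ≤ z ^ (-c) * (3 / 2 * (2 * Real.cosh (Real.pi * t)) * (1 + t ^ 2) ^ (-(1 + θ) / 2) /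
        Real.Gamma (b - 2 * c)) := by
        refine mul_le_mul_of_nonneg_left (h.trans ?_) (by positivity)
        gcongr
    _ = _ := by ring

/-! ### The Wright kernel -/

/-- The entire function `y^{-s} / (Γ(1 - s) Γ(b + γ (s - 1)))`. -/
noncomputable def wrightKernel (γ b y : ℝ) (s : ℂ) : ℂ :=
  (y : ℂ) ^ (-s) * ((Complex.Gamma (1 - s))⁻¹ * (Complex.Gamma ((b : ℂ) + (γ : ℂ) * (s - 1)))⁻¹)

lemma differentiable_wrightKernel {γ b y : ℝ} (hy : 0 < y) :
    Differentiable ℂ (wrightKernel γ b y) := by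
  have hy' : (y : ℂ) ≠ 0 := by exact_mod_cast hy.ne'
  refine Differentiable.mul (fun s => ?_) (Differentiable.mul ?_ ?_)
  · exact DifferentiableAt.const_cpow (by fun_prop) (Or.inl hy')
  · exact Complex.differentiable_one_div_Gamma.comp (by fun_prop)
  · exact Complex.differentiable_one_div_Gamma.comp (by fun_prop)

lemma tsum_wrightKernel {γ b y : ℝ} :
    ∑' n : ℕ, (-1) ^ n * wrightKernel γ b y (-(n : ℂ)) =
      wright (-γ) ((b : ℂ) - (γ : ℂ)) (-(y : ℂ)) := by
  refine tsum_congr fun n => ?_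
  have e : (b : ℂ) + (γ : ℂ) * (-(n : ℂ) - 1) = (n : ℂ) * ((-γ : ℝ) : ℂ) + ((b : ℂ) - γ) := by
    push_cast
    ring
  rw [wrightKernel, neg_neg, Complex.cpow_natCast, neg_pow (y : ℂ), e, sub_neg_eq_add, add_comm 1,
    Complex.Gamma_nat_eq_factorial, ← mul_inv, div_eq_mul_inv, mul_assoc]

lemma Gamma_div_Gamma_eq_cscKernel_mul (γ b y : ℝ) {s : ℂ}
    (hs : Complex.sin (Real.pi * s) ≠ 0) :
    Complex.Gamma s / Complex.Gamma ((b : ℂ) + (γ : ℂ) * (s - 1)) * (y : ℂ) ^ (-s) =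
      cscKernel s * wrightKernel γ b y s := by
  have h := Complex.Gamma_mul_Gamma_one_sub s
  have hne : Complex.Gamma (1 - s) ≠ 0 := by
    intro h0
    rw [h0, mul_zero] at h
    exact div_ne_zero (Complex.ofReal_ne_zero.2 Real.pi_ne_zero) hs h.symm
  rw [cscKernel, ← h, wrightKernel]
  field_simp

lemma differentiableAt_Gamma_of_re_pos {s : ℂ} (hs : 0 < s.re) :
    DifferentiableAt ℂ Complex.Gamma s := by
  refine Complex.differentiableAt_Gamma s fun m hm => ?_
  rw [hm, Complex.neg_re, Complex.natCast_re] at hs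
  linarith [m.cast_nonneg (α := ℝ)]

lemma differentiableAt_Gamma_div_Gamma (γ b : ℝ) {s : ℂ} (hs : 0 < s.re) :
    DifferentiableAt ℂ (fun s => Complex.Gamma s / Complex.Gamma ((b : ℂ) + (γ : ℂ) * (s - 1)))
      s := by
  have d2 : Differentiable ℂ fun s : ℂ => (Complex.Gamma ((b : ℂ) + (γ : ℂ) * (s - 1)))⁻¹ :=
    Complex.differentiable_one_div_Gamma.comp (by fun_prop)
  simp only [div_eq_mul_inv]
  exact (differentiableAt_Gamma_of_re_pos hs).mul (d2 s)

lemma norm_sin_pi_mul_le (z : ℂ) :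
    ‖Complex.sin (Real.pi * z)‖ ≤ Real.exp (Real.pi * |z.im|) := by
  have h := norm_sin_pi_mul_sq z.re z.im
  rw [Complex.re_add_im] at h
  have h2 := Real.cosh_le_exp_abs (Real.pi * z.im)
  rw [abs_mul, abs_of_pos Real.pi_pos] at h2
  refine le_trans (le_of_sq_le_sq ?_ (Real.cosh_pos (Real.pi * z.im)).le) h2
  rw [h, Real.cosh_sq]
  linarith [Real.sin_sq_le_one (Real.pi * z.re)]

/-- Reflection turns `1 / Γ(1 - γ w)` into `sin (π γ w) Γ(γ w) / π`, and the Beta bound gives `|Γ(γ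
w) / Γ(w)| ≤ 1 / |Γ((1 - γ) w)|`. The rates `π γ` and `π (1 - γ) / 2` add up to `π (1 + γ) / 2`. -/
lemma norm_inv_Gamma_mul_inv_Gamma_one_sub_le {γ : ℝ} {w : ℂ} (h1 : 1 ≤ γ * w.re)
    (h2 : 1 ≤ (1 - γ) * w.re) (hγ0 : 0 < γ) (hγ1 : γ < 1) :
    ‖(Complex.Gamma w)⁻¹ * (Complex.Gamma (1 - γ * w))⁻¹‖ ≤
      Real.exp (Real.pi / 2 * (1 + γ) * |w.im|) / Real.Gamma ((1 - γ) * w.re) := by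
  have hpi : (Real.pi : ℂ) ≠ 0 := Complex.ofReal_ne_zero.2 Real.pi_ne_zero
  have hne : Complex.Gamma (γ * w) ≠ 0 :=
    Complex.Gamma_ne_zero_of_re_pos (by simp only [Complex.re_ofReal_mul]; linarith)
  have hG := Real.Gamma_pos_of_pos (by linarith : 0 < (1 - γ) * w.re)
  have hr := Complex.Gamma_mul_Gamma_one_sub (γ * w)
  have e : (Complex.Gamma (1 - γ * w))⁻¹ =
      Complex.sin (Real.pi * (γ * w)) / Real.pi * Complex.Gamma (γ * w) := by
    have h3 : Complex.Gamma (1 - γ * w) =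
        Real.pi / Complex.sin (Real.pi * (γ * w)) / Complex.Gamma (γ * w) := by
      rw [← hr]
      field_simp
    rw [h3, inv_div, div_div_eq_mul_div]
    ring
  have h4 := norm_Gamma_mul_inv_Gamma_add_le (a := γ * w) (d := ((1 - γ : ℝ) : ℂ) * w)
    (by simpa using h1) (by rwa [Complex.re_ofReal_mul])
  rw [show (γ : ℂ) * w + ((1 - γ : ℝ) : ℂ) * w = w by push_cast; ring] at h4
  have h5 := norm_inv_Gamma_le (x := (1 - γ) * w.re) (by linarith) ((1 - γ) * w.im)
  rw [show ((((1 - γ) * w.re : ℝ) : ℂ) + (((1 - γ) * w.im : ℝ) : ℂ) * Complex.I) =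
    ((1 - γ : ℝ) : ℂ) * w by
      apply Complex.ext <;> simp] at h5
  have h6 : ‖Complex.sin (Real.pi * (γ * w)) / Real.pi‖ ≤ Real.exp (Real.pi * (γ * |w.im|)) := by
    rw [norm_div, Complex.norm_real, Real.norm_of_nonneg Real.pi_pos.le]
    refine (div_le_self (norm_nonneg _) (by linarith [Real.pi_gt_three])).trans ?_
    have := norm_sin_pi_mul_le (γ * w)
    rwa [Complex.im_ofReal_mul, abs_mul, abs_of_pos hγ0] at this
  rw [e, mul_comm, mul_assoc, norm_mul]
  refine (mul_le_mul h6 (h4.trans h5) (norm_nonneg _) (Real.exp_pos _).le).trans_eq ?_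
  rw [abs_mul, abs_of_pos (by linarith : 0 < 1 - γ), ← mul_div_assoc, ← Real.exp_add]
  congr 2
  ring

lemma norm_inv_Gamma_two_sub_le {z : ℂ} (hz : 2 ≤ z.re) :
    ‖(Complex.Gamma (2 - z))⁻¹‖ ≤ ‖(Complex.Gamma (1 - z))⁻¹‖ := by
  have hre : 1 ≤ ‖1 - z‖ := by
    have := Complex.abs_re_le_norm (1 - z)
    have h2 := neg_abs_le (1 - z).re
    simp only [Complex.sub_re, Complex.one_re] at this h2
    linarith
  have hne : 1 - z ≠ 0 := norm_pos_iff.1 (by linarith)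
  rw [show (2 : ℂ) - z = (1 - z) + 1 by ring, Complex.Gamma_add_one _ hne, mul_inv, norm_mul,
    norm_inv]
  exact mul_le_of_le_one_left (norm_nonneg _) (inv_le_one_of_one_le₀ hre)

lemma hasBromwichIntegral_wright {γ b c y : ℝ} (hγ0 : 0 < γ) (hγ1 : γ < 1) (hb : b = 1 ∨ b = 2)
    (hc : 0 < c) (hy : 0 < y) :
    HasBromwichIntegral c (fun s => Complex.Gamma s / Complex.Gamma ((b : ℂ) + (γ : ℂ) * (s - 1)) *
      (y : ℂ) ^ (-s)) (wright (-γ) ((b : ℂ) - (γ : ℂ)) (-(y : ℂ))) := by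
  have hpi := Real.pi_pos
  have hγ' : 0 < 1 - γ := by linarith
  have hy' : (y : ℂ) ≠ 0 := by exact_mod_cast hy.ne'
  set ε := Real.pi * (1 - γ) / 8 with hε
  have hε0 : 0 < ε := by positivity
  rw [← tsum_wrightKernel]
  refine hasBromwichIntegral_of_exp (c₀ := min c (1 / 2)) (θ := (Real.pi / 2 + ε) * (1 + γ))
    (lt_min hc (by norm_num)) ((min_le_right _ _).trans_lt (by norm_num)) (min_le_left _ _)
    (fun s hs => ?_) (fun s hs => Gamma_div_Gamma_eq_cscKernel_mul γ b y hs)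
    (differentiable_wrightKernel hy) ?_ ?_ ?_
  · refine ((differentiableAt_Gamma_div_Gamma γ b ((lt_min hc (by norm_num)).trans_le hs.1)).mul
      ?_).differentiableWithinAt
    exact DifferentiableAt.const_cpow (by fun_prop) (Or.inl hy')
  · rw [hε]
    nlinarith [mul_pos hpi hγ0, mul_pos hpi hγ', mul_pos (mul_pos hpi hγ') hγ0]
  · intro a
    obtain ⟨C₁, hC₁, hle₁⟩ := exists_norm_inv_Gamma_le_strip hε0 (1 - c) (1 - a)
    obtain ⟨C₂, hC₂, hle₂⟩ := exists_norm_inv_Gamma_le_strip hε0 (b + γ * (a - 1))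
      (b + γ * (c - 1))
    refine ⟨(y ^ (-a) + y ^ (-c)) * (C₁ * C₂), fun s hs1 hs2 => ?_⟩
    have i1 := hle₁ (1 - s) (by rw [Complex.sub_re, Complex.one_re]; linarith)
      (by rw [Complex.sub_re, Complex.one_re]; linarith)
    have i2 := hle₂ ((b : ℂ) + (γ : ℂ) * (s - 1)) (by simp; nlinarith) (by simp; nlinarith)
    rw [wrightKernel, norm_mul, norm_ofReal_cpow_neg hy, norm_mul, mul_assoc]
    refine mul_le_mul (rpow_neg_le_add hy hs1 hs2)
      ((mul_le_mul i1 i2 (norm_nonneg _) (by positivity)).trans_eq ?_) (by positivity)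
      (by positivity)
    have e1 : |(1 - s).im| = |s.im| := by simp
    have e2 : |((b : ℂ) + (γ : ℂ) * (s - 1)).im| = γ * |s.im| := by
      simp [abs_mul, abs_of_pos hγ0]
    rw [e1, e2, mul_mul_mul_comm, ← Real.exp_add]
    ring_nf
  · obtain ⟨C, hC0, hC⟩ := exists_rpow_div_Gamma_le hy hγ'
    -- The first threshold makes `Re (γ w) ≥ 2`, needed to compare `b = 2` with `b = 1`; the second
    -- serves the Beta bound. The factor `y⁻¹` comes from `Re w = u + 1`, which calls for the power
    -- `y^(u + 1)`.
    refine ⟨y⁻¹ * C, max (2 / γ) (1 / (1 - γ)), fun u t hu => ?_⟩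
    have hu1 : 2 ≤ γ * u := by
      have := (le_max_left _ _).trans hu
      rwa [div_le_iff₀' hγ0] at this
    have hu2 : 1 ≤ (1 - γ) * u := by
      have := (le_max_right _ _).trans hu
      rwa [div_le_iff₀' hγ'] at this
    set w : ℂ := 1 - (-u + t * Complex.I) with hw
    have hre : w.re = u + 1 := by simp [hw]; ring
    have him : |w.im| = |t| := by simp [hw]
    have hw1 : 1 ≤ (1 - γ) * (u + 1) := by linarith
    have key : ‖(Complex.Gamma w)⁻¹ * (Complex.Gamma ((b : ℂ) - γ * w))⁻¹‖ ≤
        Real.exp (Real.pi / 2 * (1 + γ) * |t|) / Real.Gamma ((1 - γ) * (u + 1)) := by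
      have h := norm_inv_Gamma_mul_inv_Gamma_one_sub_le (γ := γ) (w := w)
        (by rw [hre]; linarith) (by rwa [hre]) hγ0 hγ1
      rw [hre, him] at h
      refine le_trans ?_ h
      rcases hb with rfl | rfl
      · simp
      · rw [norm_mul, norm_mul]
        refine mul_le_mul_of_nonneg_left ?_ (norm_nonneg _)
        have := norm_inv_Gamma_two_sub_le (z := γ * w)
          (by rw [Complex.re_ofReal_mul, hre]; linarith)
        simpa using this
    have hG := Real.Gamma_pos_of_pos (by linarith : 0 < (1 - γ) * (u + 1))
    have e : (b : ℂ) + (γ : ℂ) * ((-u + t * Complex.I) - 1) = (b : ℂ) - γ * w := by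
      rw [hw]
      ring
    have hpow : ‖(y : ℂ) ^ (-(-u + t * Complex.I : ℂ))‖ = y⁻¹ * y ^ (u + 1) := by
      rw [norm_ofReal_cpow_neg hy, Real.rpow_add_one hy.ne']
      simp
      field_simp
    rw [wrightKernel, norm_mul, e, hpow]
    have h7 := hC (u + 1) hw1
    have h8 : (2 : ℝ) ^ (-(u + 1)) ≤ 2 ^ (-u) :=
      Real.rpow_le_rpow_of_exponent_le one_le_two (by linarith)
    have h9 : Real.exp (Real.pi / 2 * (1 + γ) * |t|) ≤
        Real.exp ((Real.pi / 2 + ε) * (1 + γ) * |t|) := by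
      refine Real.exp_le_exp.2 ?_
      linarith [mul_nonneg (mul_nonneg hε0.le (by linarith : 0 ≤ 1 + γ)) (abs_nonneg t)]
    calc _ ≤ y⁻¹ * y ^ (u + 1) * (Real.exp (Real.pi / 2 * (1 + γ) * |t|) /
          Real.Gamma ((1 - γ) * (u + 1))) := by gcongr
      _ = y⁻¹ * (y ^ (u + 1) / Real.Gamma ((1 - γ) * (u + 1))) *
          Real.exp (Real.pi / 2 * (1 + γ) * |t|) := by ring
      _ ≤ y⁻¹ * (C * 2 ^ (-u)) * Real.exp ((Real.pi / 2 + ε) * (1 + γ) * |t|) := by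
          gcongr
          exact h7.trans (by gcongr)
      _ = _ := by ring

/-! ### Mellin transforms from absolutely convergent integrals -/

lemma hasMellin_mittagLeffler {β b : ℝ} {s : ℂ} (h0 : 0 < β) (h2 : β < 2) (hb : 0 ≤ b)
    (hs0 : 0 < s.re) (hs1 : s.re < 1) :
    HasMellin (fun x : ℝ => mittagLeffler β b (-(x : ℂ))) s
      (Complex.Gamma s * Complex.Gamma (1 - s) / Complex.Gamma ((b : ℂ) - (β : ℂ) * s)) := by
  refine hasMellin_of_hasBromwichIntegral (G := fun s => Complex.Gamma s * Complex.Gamma (1 - s) /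
      Complex.Gamma ((b : ℂ) - (β : ℂ) * s)) (a := 0) (b := 1) (fun c hc0 hc1 x hx =>
    hasBromwichIntegral_mittagLeffler h0 h2 hb hc0 hc1 hx) hs0 hs1 ?_
  exact continuous_line_of_differentiableOn le_rfl fun z hz =>
    (differentiableAt_Gamma_mul_Gamma_div β b (hs0.trans_le hz.1)
      (hz.2.trans_lt hs1)).differentiableWithinAt

lemma hasMellin_wright {γ b : ℝ} {s : ℂ} (hγ0 : 0 < γ) (hγ1 : γ < 1) (hb : b = 1 ∨ b = 2)
    (hs : 0 < s.re) :
    HasMellin (fun y : ℝ => wright (-γ) ((b : ℂ) - (γ : ℂ)) (-(y : ℂ))) s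
      (Complex.Gamma s / Complex.Gamma ((b : ℂ) + (γ : ℂ) * (s - 1))) := by
  refine hasMellin_of_hasBromwichIntegral (G := fun s => Complex.Gamma s /
      Complex.Gamma ((b : ℂ) + (γ : ℂ) * (s - 1))) (a := 0) (b := s.re + 1)
    (fun c hc0 _ x hx => hasBromwichIntegral_wright hγ0 hγ1 hb hc0 hx) hs (by linarith) ?_
  exact continuous_line_of_differentiableOn le_rfl fun z hz =>
    (differentiableAt_Gamma_div_Gamma γ b (hs.trans_le hz.1)).differentiableWithinAt

/-- `b ≥ 7/2` ensures `b - 2c > 3/2` for all `0 < c < 1`, hence absolute convergence on every line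
of the strip. -/
lemma hasMellin_mittagLeffler_two {b : ℝ} {s : ℂ} (hb : 7 / 2 ≤ b)
    (hs0 : 0 < s.re) (hs1 : s.re < 1) :
    HasMellin (fun x : ℝ => mittagLeffler 2 b (-(x : ℂ))) s
      (Complex.Gamma s * Complex.Gamma (1 - s) / Complex.Gamma ((b : ℂ) - ((2 : ℝ) : ℂ) * s)) := by
  refine hasMellin_of_hasBromwichIntegral (G := fun s => Complex.Gamma s * Complex.Gamma (1 - s) /
      Complex.Gamma ((b : ℂ) - ((2 : ℝ) : ℂ) * s)) (a := 0) (b := 1) (fun c hc0 hc1 x hx =>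
    hasBromwichIntegral_mittagLeffler_two (by linarith) (by linarith) hc0 hc1 hx) hs0 hs1 ?_
  exact continuous_line_of_differentiableOn le_rfl fun z hz =>
    (differentiableAt_Gamma_mul_Gamma_div 2 b (hs0.trans_le hz.1)
      (hz.2.trans_lt hs1)).differentiableWithinAt

/-! ### Order 2: trigonometric closed forms and integration by parts -/

lemma Complex.ofReal_sqrt_pow_two_mul {x : ℝ} (hx : 0 ≤ x) (n : ℕ) :
    ((√x : ℝ) : ℂ) ^ (2 * n) = (x : ℂ) ^ n := by
  rw [pow_mul, ← Complex.ofReal_pow, Real.sq_sqrt hx]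

lemma hasSum_mittagLeffler_two_one {x : ℝ} (hx : 0 < x) :
    HasSum (fun n : ℕ => (-(x : ℂ)) ^ n / Complex.Gamma ((n : ℂ) * ((2 : ℝ) : ℂ) + 1))
      (Real.cos √x : ℂ) := by
  rw [Complex.ofReal_cos]
  refine (Complex.hasSum_cos ((√x : ℝ) : ℂ)).congr_fun fun n => ?_
  rw [Complex.ofReal_sqrt_pow_two_mul hx.le, neg_pow (x : ℂ), ← Complex.Gamma_nat_eq_factorial]
  congr 2
  push_cast
  ring

lemma hasSum_mittagLeffler_two_two {x : ℝ} (hx : 0 < x) :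
    HasSum (fun n : ℕ => (-(x : ℂ)) ^ n / Complex.Gamma ((n : ℂ) * ((2 : ℝ) : ℂ) + 2))
      ((Real.sin √x / √x : ℝ) : ℂ) := by
  have hr : ((√x : ℝ) : ℂ) ≠ 0 := by exact_mod_cast (Real.sqrt_pos.2 hx).ne'
  rw [Complex.ofReal_div, Complex.ofReal_sin]
  refine ((Complex.hasSum_sin ((√x : ℝ) : ℂ)).div_const ((√x : ℝ) : ℂ)).congr_fun fun n => ?_
  rw [pow_succ, Complex.ofReal_sqrt_pow_two_mul hx.le, neg_pow (x : ℂ),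
    ← Complex.Gamma_nat_eq_factorial]
  have : ((2 * n + 1 : ℕ) : ℂ) + 1 = (n : ℂ) * ((2 : ℝ) : ℂ) + 2 := by
    push_cast
    ring
  rw [this]
  field_simp

lemma mittagLeffler_eq_add_mul {a : ℝ} {b z : ℂ}
    (h : Summable fun n : ℕ => z ^ n / Complex.Gamma ((n : ℂ) * (a : ℂ) + b)) :
    mittagLeffler a b z = 1 / Complex.Gamma b + z * mittagLeffler a (b + a) z := by
  rw [mittagLeffler, h.tsum_eq_zero_add, mittagLeffler, ← tsum_mul_left]
  congr 1
  · simp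
  · refine tsum_congr fun n => ?_
    rw [pow_succ', mul_div_assoc]
    congr 3
    push_cast
    ring

lemma mittagLeffler_two_one {x : ℝ} (hx : 0 < x) :
    mittagLeffler 2 1 (-(x : ℂ)) = (Real.cos √x : ℂ) := (hasSum_mittagLeffler_two_one hx).tsum_eq

lemma mittagLeffler_two_two {x : ℝ} (hx : 0 < x) :
    mittagLeffler 2 2 (-(x : ℂ)) = ((Real.sin √x / √x : ℝ) : ℂ) :=
  (hasSum_mittagLeffler_two_two hx).tsum_eq

lemma mittagLeffler_two_four {x : ℝ} (hx : 0 < x) :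
    mittagLeffler 2 4 (-(x : ℂ)) = (((1 - Real.sin √x / √x) / x : ℝ) : ℂ) := by
  have hx' : (x : ℂ) ≠ 0 := by exact_mod_cast hx.ne'
  have h := mittagLeffler_eq_add_mul (hasSum_mittagLeffler_two_two hx).summable
  have hG : Complex.Gamma 2 = 1 := by
    rw [← one_add_one_eq_two, Complex.Gamma_add_one _ one_ne_zero, Complex.Gamma_one, mul_one]
  rw [mittagLeffler_two_two hx, hG,
    show (2 : ℂ) + ((2 : ℝ) : ℂ) = 4 by push_cast; norm_num] at h
  rw [Complex.ofReal_div, Complex.ofReal_sub, h]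
  push_cast
  field_simp
  ring

lemma hasDerivAt_cos_sqrt {x : ℝ} (hx : 0 < x) :
    HasDerivAt (fun x => Real.cos √x) (-(Real.sin √x / √x) / 2) x := by
  refine ((Real.hasDerivAt_sqrt hx.ne').cos).congr_deriv ?_
  have := (Real.sqrt_pos.2 hx).ne'
  field_simp

lemma hasDerivAt_sin_sqrt_div_sqrt {x : ℝ} (hx : 0 < x) :
    HasDerivAt (fun x => Real.sin √x / √x)
      ((Real.cos √x / 2 - 1 / 2 * (Real.sin √x / √x)) / x) x := by
  have h := Real.sqrt_pos.2 hx
  refine ((Real.hasDerivAt_sqrt hx.ne').sin.div (Real.hasDerivAt_sqrt hx.ne') h.ne').congr_deriv ?_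
  have h2 : √x ^ 2 = x := Real.sq_sqrt hx.le
  rw [← h2]
  simp only [Real.sqrt_sq h.le]
  field_simp

lemma hasDerivAt_one_sub_cos_sqrt_div {x : ℝ} (hx : 0 < x) :
    HasDerivAt (fun x => (1 - Real.cos √x) / x)
      (((Real.sin √x / √x) / 2 - 2 / 2 * ((1 - Real.cos √x) / x)) / x) x := by
  refine (((hasDerivAt_cos_sqrt hx).const_sub 1).div (hasDerivAt_id x) hx.ne').congr_deriv ?_
  simp only [id]
  field_simp

lemma hasDerivAt_one_sub_sin_sqrt_div_sqrt_div {x : ℝ} (hx : 0 < x) :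
    HasDerivAt (fun x => (1 - Real.sin √x / √x) / x)
      ((((1 - Real.cos √x) / x) / 2 - 3 / 2 * ((1 - Real.sin √x / √x) / x)) / x) x := by
  refine (((hasDerivAt_sin_sqrt_div_sqrt hx).const_sub 1).div
    (hasDerivAt_id x) hx.ne').congr_deriv ?_
  have := (Real.sqrt_pos.2 hx).ne'
  simp only [id]
  field_simp
  ring

lemma abs_sin_sqrt_div_sqrt_le_one {x : ℝ} (hx : 0 < x) : |Real.sin √x / √x| ≤ 1 := by
  have h := Real.sqrt_pos.2 hx
  rw [abs_div, abs_of_pos h, div_le_one h]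
  simpa [abs_of_pos h] using Real.abs_sin_le_abs (x := √x)

lemma abs_one_sub_cos_sqrt_div_le {x : ℝ} (hx : 0 < x) : |(1 - Real.cos √x) / x| ≤ 2 := by
  have h1 := Real.one_sub_sq_div_two_le_cos (x := √x)
  rw [Real.sq_sqrt hx.le] at h1
  rw [abs_of_nonneg (div_nonneg (by linarith [Real.cos_le_one √x]) hx.le), div_le_iff₀ hx]
  linarith

lemma abs_one_sub_cos_sqrt_div_le_rpow {x : ℝ} (hx : 0 < x) :
    |(1 - Real.cos √x) / x| ≤ 2 * x ^ (-1 : ℝ) := by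
  rw [abs_of_nonneg (div_nonneg (by linarith [Real.cos_le_one √x]) hx.le), Real.rpow_neg_one,
    div_eq_mul_inv]
  have := Real.neg_one_le_cos √x
  gcongr
  linarith

lemma abs_one_sub_sin_sqrt_div_sqrt_div_le_rpow {x : ℝ} (hx : 0 < x) :
    |(1 - Real.sin √x / √x) / x| ≤ 2 * x ^ (-1 : ℝ) := by
  have h := abs_le.1 (abs_sin_sqrt_div_sqrt_le_one hx)
  rw [abs_of_nonneg (div_nonneg (by linarith) hx.le), Real.rpow_neg_one, div_eq_mul_inv]
  gcongr
  linarith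

lemma abs_one_sub_sin_sqrt_div_sqrt_div_le {x : ℝ} (hx : 0 < x) :
    |(1 - Real.sin √x / √x) / x| ≤ 2 := by
  have h := Real.sqrt_pos.2 hx
  have h0 := abs_le.1 (abs_sin_sqrt_div_sqrt_le_one hx)
  rw [abs_of_nonneg (div_nonneg (by linarith) hx.le), div_le_iff₀ hx]
  have h2 := Real.sin_gt_sub_cube h
  have h3 : 1 - x / 6 ≤ Real.sin √x / √x := by
    rw [le_div_iff₀ h]
    have h4 : √x ^ 3 = x * √x := by rw [pow_succ, Real.sq_sqrt hx.le]
    rw [h4] at h2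
    linarith
  linarith

lemma intervalIntegrable_cpow_mul_of_bdd {p : ℝ → ℂ} {s : ℂ} {M : ℝ} (hs : 0 < s.re)
    (hp : ContinuousOn p (Set.Ioi 0)) (hM : ∀ x, 0 < x → ‖p x‖ ≤ M) {R : ℝ} (hR : 0 < R) :
    IntervalIntegrable (fun x : ℝ => (x : ℂ) ^ (s - 1) * p x) MeasureTheory.volume 0 R := by
  have h1 : IntervalIntegrable (fun x : ℝ => (x : ℂ) ^ (s - 1)) MeasureTheory.volume 0 R :=
    intervalIntegral.intervalIntegrable_cpow' (by simpa using hs)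
  rw [intervalIntegrable_iff_integrableOn_Ioc_of_le hR.le] at h1 ⊢
  refine MeasureTheory.Integrable.mul_bdd (c := M) h1 ?_ ?_
  · exact (hp.mono fun x hx => hx.1).aestronglyMeasurable measurableSet_Ioc
  · filter_upwards [MeasureTheory.ae_restrict_mem measurableSet_Ioc] with x hx using hM x hx.1

/-- Integration by parts against `x ^ s`: from the improper Mellin transform of `q` to that of `p`,
where `(x ^ (b / 2) q)' = x ^ (b / 2 - 1) p / 2`. -/
lemma HasImproperMellin.of_hasDerivAt {p q : ℝ → ℂ} {b κ M : ℝ} {s m : ℂ}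
    (hq : HasImproperMellin q s m) (hs : 0 < s.re) (hκ : s.re < κ)
    (hpc : ContinuousOn p (Set.Ioi 0)) (hpM : ∀ x, 0 < x → ‖p x‖ ≤ M)
    (hqM : ∀ x, 0 < x → ‖q x‖ ≤ M) (hqκ : ∀ x, 0 < x → ‖q x‖ ≤ M * x ^ (-κ))
    (hd : ∀ x : ℝ, 0 < x → HasDerivAt q ((p x / 2 - b / 2 * q x) / x) x) :
    HasImproperMellin p s ((b - 2 * s) * m) := by
  have hs0 : s ≠ 0 := fun h => by simp [h] at hs
  have hpI : ∀ R : ℝ, 0 < R → IntervalIntegrable (fun x : ℝ => (x : ℂ) ^ (s - 1) * p x)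
      MeasureTheory.volume 0 R := fun R hR => intervalIntegrable_cpow_mul_of_bdd hs hpc hpM hR
  refine ⟨hpI, ?_⟩
  set F : ℝ → ℂ := fun x => (x : ℂ) ^ s * q x with hF
  have hFd : ∀ x : ℝ, 0 < x → HasDerivAt F (1 / 2 * ((x : ℂ) ^ (s - 1) * p x) +
      (s - b / 2) * ((x : ℂ) ^ (s - 1) * q x)) x := by
    intro x hx
    have hx' : (x : ℂ) ≠ 0 := by exact_mod_cast hx.ne'
    have h1 : HasDerivAt (fun x : ℝ => (x : ℂ) ^ s) (s * (x : ℂ) ^ (s - 1)) x := by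
      have h2 := (hasDerivAt_id (x : ℂ)).cpow_const (c := s)
        (Or.inl (by simpa using hx) : (id (x : ℂ)) ∈ Complex.slitPlane)
      simpa using h2.comp_ofReal
    refine (h1.mul (hd x hx)).congr_deriv ?_
    have e : (x : ℂ) ^ s = (x : ℂ) ^ (s - 1) * x := by
      rw [Complex.cpow_sub _ _ hx', Complex.cpow_one, div_mul_cancel₀ _ hx']
    rw [e]
    field_simp
    ring
  have hFM : ∀ x : ℝ, 0 < x → ‖F x‖ ≤ x ^ s.re * M := fun x hx => by
    rw [hF, norm_mul, Complex.norm_cpow_eq_rpow_re_of_pos hx]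
    exact mul_le_mul_of_nonneg_left (hqM x hx) (by positivity)
  have hF0 : F 0 = 0 := by simp [hF, Complex.zero_cpow hs0]
  have hFc : ∀ R : ℝ, ContinuousOn F (Set.Icc 0 R) := by
    intro R x hx
    rcases hx.1.eq_or_lt with rfl | hx0
    · rw [ContinuousWithinAt, hF0]
      have hlim : Tendsto (fun x : ℝ => x ^ s.re * M) (𝓝[Set.Icc 0 R] 0) (𝓝 0) := by
        have := ((Real.continuousAt_rpow_const 0 s.re (Or.inr hs.le)).tendsto.mul_const
          M).mono_left (nhdsWithin_le_nhds (s := Set.Icc 0 R))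
        simpa [Real.zero_rpow hs.ne'] using this
      refine squeeze_zero_norm' ?_ hlim
      filter_upwards [self_mem_nhdsWithin] with y hy
      rcases hy.1.eq_or_lt with rfl | hy0
      · rw [hF0, norm_zero, Real.zero_rpow hs.ne', zero_mul]
      · exact hFM y hy0
    · exact (hFd x hx0).continuousAt.continuousWithinAt
  -- `Re s < κ` is what kills the boundary term at infinity.
  have hFtop : Tendsto F atTop (𝓝 0) := by
    have hlim : Tendsto (fun x : ℝ => M * x ^ (-(κ - s.re))) atTop (𝓝 0) := by
      simpa using (tendsto_rpow_neg_atTop (sub_pos.2 hκ)).const_mul M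
    refine squeeze_zero_norm' ?_ hlim
    filter_upwards [eventually_gt_atTop 0] with x hx
    rw [hF, norm_mul, Complex.norm_cpow_eq_rpow_re_of_pos hx]
    refine (mul_le_mul_of_nonneg_left (hqκ x hx) (by positivity)).trans_eq ?_
    rw [mul_left_comm, ← Real.rpow_add hx]
    ring_nf
  have hFTC : ∀ R : ℝ, 0 < R → (∫ x in (0 : ℝ)..R, (x : ℂ) ^ (s - 1) * p x) =
      2 * F R - (2 * s - b) * ∫ x in (0 : ℝ)..R, (x : ℂ) ^ (s - 1) * q x := by
    intro R hR
    have h := intervalIntegral.integral_eq_sub_of_hasDerivAt_of_le hR.le (hFc R)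
      (fun x hx => hFd x hx.1) (((hpI R hR).const_mul _).add ((hq.1 R hR).const_mul _))
    rw [intervalIntegral.integral_add ((hpI R hR).const_mul _) ((hq.1 R hR).const_mul _),
      intervalIntegral.integral_const_mul, intervalIntegral.integral_const_mul, hF0] at h
    linear_combination 2 * h
  have hlim := (hFtop.const_mul 2).sub (hq.2.const_mul (2 * s - b))
  rw [mul_zero, zero_sub, ← neg_mul, neg_sub] at hlim
  refine hlim.congr' ?_
  filter_upwards [eventually_gt_atTop 0] with R hR
  exact (hFTC R hR).symm

lemma HasMellin.hasImproperMellin {f : ℝ → ℂ} {s m : ℂ} (h : HasMellin f s m) :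
    HasImproperMellin f s m := by
  have hi : MeasureTheory.IntegrableOn (fun x : ℝ => (x : ℂ) ^ (s - 1) * f x) (Set.Ioi 0) := h.1
  refine ⟨fun R hR => ?_, ?_⟩
  · rw [intervalIntegrable_iff_integrableOn_Ioc_of_le hR.le]
    exact hi.mono_set fun x hx => hx.1
  · rw [← h.2]
    exact MeasureTheory.intervalIntegral_tendsto_integral_Ioi 0 hi tendsto_id

lemma HasImproperMellin.congr {f g : ℝ → ℂ} {s m : ℂ} (h : HasImproperMellin f s m)
    (hfg : ∀ x, 0 < x → f x = g x) : HasImproperMellin g s m := by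
  have he : ∀ R : ℝ, 0 < R → Set.EqOn (fun x : ℝ => (x : ℂ) ^ (s - 1) * f x)
      (fun x : ℝ => (x : ℂ) ^ (s - 1) * g x) (Set.uIoc 0 R) := fun R hR x hx => by
    rw [Set.uIoc_of_le hR.le] at hx
    simp only [hfg x hx.1]
  refine ⟨fun R hR => (h.1 R hR).congr (he R hR), h.2.congr' ?_⟩
  filter_upwards [eventually_gt_atTop 0] with R hR
  exact intervalIntegral.integral_congr_ae (Eventually.of_forall (he R hR))

/-- The factor `b - 2s` produced by each integration by parts lowers the argument of the Gamma
function by one. -/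
lemma sub_mul_div_Gamma_add_one_sub (X : ℂ) {b s : ℂ} (h : b - 2 * s ≠ 0) :
    (b - 2 * s) * (X / Complex.Gamma (b + 1 - 2 * s)) = X / Complex.Gamma (b - 2 * s) := by
  rw [show b + 1 - 2 * s = b - 2 * s + 1 by ring, Complex.Gamma_add_one _ h]
  field_simp

/-- The function is `E_{2,3}(-x)`, reached from `E_{2,4}(-x) = (1 - sin √x / √x) / x`. -/
lemma hasImproperMellin_one_sub_cos_sqrt_div {s : ℂ} (h0 : 0 < s.re) (h1 : s.re < 1) :
    HasImproperMellin (fun x : ℝ => (((1 - Real.cos √x) / x : ℝ) : ℂ)) s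
      (Complex.Gamma s * Complex.Gamma (1 - s) / Complex.Gamma (3 - 2 * s)) := by
  have h := (hasMellin_mittagLeffler_two (b := 4) (by norm_num) h0 h1).hasImproperMellin
  push_cast at h
  have h2 := (h.congr fun x hx => mittagLeffler_two_four hx).of_hasDerivAt (b := 3) (M := 2)
    (p := fun x : ℝ => (((1 - Real.cos √x) / x : ℝ) : ℂ)) h0 h1
    (fun x hx => (hasDerivAt_one_sub_cos_sqrt_div hx).ofReal_comp.continuousAt.continuousWithinAt)
    (fun x hx => by simpa only [Complex.norm_real, Real.norm_eq_abs] using abs_one_sub_cos_sqrt_div_le hx)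
    (fun x hx => by simpa only [Complex.norm_real, Real.norm_eq_abs] using abs_one_sub_sin_sqrt_div_sqrt_div_le hx)
    (fun x hx => by
      simpa only [Complex.norm_real, Real.norm_eq_abs] using abs_one_sub_sin_sqrt_div_sqrt_div_le_rpow hx)
    (fun x hx => by
      convert (hasDerivAt_one_sub_sin_sqrt_div_sqrt_div hx).ofReal_comp using 1
      push_cast
      rfl)
  have h3 := sub_mul_div_Gamma_add_one_sub (Complex.Gamma s * Complex.Gamma (1 - s))
    (b := 3) (s := s) (fun h => by
      have := congrArg Complex.re h
      simp at this
      linarith)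
  rw [← h3]
  norm_num at h2 ⊢
  exact h2

lemma hasImproperMellin_sin_sqrt_div_sqrt {s : ℂ} (h0 : 0 < s.re) (h1 : s.re < 1) :
    HasImproperMellin (fun x : ℝ => ((Real.sin √x / √x : ℝ) : ℂ)) s
      (Complex.Gamma s * Complex.Gamma (1 - s) / Complex.Gamma (2 - 2 * s)) := by
  have h2 := (hasImproperMellin_one_sub_cos_sqrt_div h0 h1).of_hasDerivAt (b := 2) (M := 2)
    (p := fun x : ℝ => ((Real.sin √x / √x : ℝ) : ℂ)) h0 h1
    (fun x hx => (hasDerivAt_sin_sqrt_div_sqrt hx).ofReal_comp.continuousAt.continuousWithinAt)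
    (fun x hx => by
      simpa only [Complex.norm_real, Real.norm_eq_abs] using (abs_sin_sqrt_div_sqrt_le_one hx).trans one_le_two)
    (fun x hx => by simpa only [Complex.norm_real, Real.norm_eq_abs] using abs_one_sub_cos_sqrt_div_le hx)
    (fun x hx => by simpa only [Complex.norm_real, Real.norm_eq_abs] using abs_one_sub_cos_sqrt_div_le_rpow hx)
    (fun x hx => by
      convert (hasDerivAt_one_sub_cos_sqrt_div hx).ofReal_comp using 1
      push_cast
      rfl)
  have h3 := sub_mul_div_Gamma_add_one_sub (Complex.Gamma s * Complex.Gamma (1 - s))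
    (b := 2) (s := s) (fun h => by
      have := congrArg Complex.re h
      simp at this
      linarith)
  rw [← h3]
  norm_num at h2 ⊢
  exact h2

/-- The boundary term now contains `sin √x / √x`, bounded by a multiple of `x^(-1/2)`; so `κ = 1/2`,
which gives the narrower strip. -/
lemma hasImproperMellin_cos_sqrt {s : ℂ} (h0 : 0 < s.re) (h1 : s.re < 1 / 2) :
    HasImproperMellin (fun x : ℝ => (Real.cos √x : ℂ)) s
      (Complex.Gamma s * Complex.Gamma (1 - s) / Complex.Gamma (1 - 2 * s)) := by
  have h2 := (hasImproperMellin_sin_sqrt_div_sqrt h0 (by linarith)).of_hasDerivAt (b := 1) (M := 2)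
    (p := fun x : ℝ => (Real.cos √x : ℂ)) h0 h1
    (fun x hx => (hasDerivAt_cos_sqrt hx).ofReal_comp.continuousAt.continuousWithinAt)
    (fun x hx => by
      simpa only [Complex.norm_real, Real.norm_eq_abs] using (Real.abs_cos_le_one √x).trans one_le_two)
    (fun x hx => by
      simpa only [Complex.norm_real, Real.norm_eq_abs] using (abs_sin_sqrt_div_sqrt_le_one hx).trans one_le_two)
    (fun x hx => by
      rw [Complex.norm_real, Real.norm_eq_abs, abs_div, abs_of_nonneg (Real.sqrt_nonneg x),
        Real.rpow_neg hx.le, ← Real.sqrt_eq_rpow, div_eq_mul_inv]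
      gcongr
      exact (Real.abs_sin_le_one √x).trans one_le_two)
    (fun x hx => by
      convert (hasDerivAt_sin_sqrt_div_sqrt hx).ofReal_comp using 1
      push_cast
      rfl)
  have h3 := sub_mul_div_Gamma_add_one_sub (Complex.Gamma s * Complex.Gamma (1 - s))
    (b := 1) (s := s) (fun h => by
      have := congrArg Complex.re h
      simp at this
      linarith)
  rw [← h3]
  norm_num at h2 ⊢
  exact h2

theorem mainTheorem3 :
    -- the Mittag-Leffler functions, order `0 < β < 2`
    (∀ β : ℝ, 0 < β → β < 2 →
      (∀ c : ℝ, 0 < c → c < 1 → ∀ z : ℝ, 0 < z →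
        HasBromwichIntegral c
          (fun s => Complex.Gamma s * Complex.Gamma (1 - s) / Complex.Gamma (1 - (β : ℂ) * s)
            * (z : ℂ) ^ (-s))
          (mittagLeffler β 1 (-(z : ℂ))) ∧
        HasBromwichIntegral c
          (fun s => Complex.Gamma s * Complex.Gamma (1 - s) / Complex.Gamma (2 - (β : ℂ) * s)
            * (z : ℂ) ^ (-s))
          (mittagLeffler β 2 (-(z : ℂ)))) ∧
      (∀ s : ℂ, 0 < s.re → s.re < 1 →
        HasMellin (fun x : ℝ => mittagLeffler β 1 (-(x : ℂ))) s
          (Complex.Gamma s * Complex.Gamma (1 - s) / Complex.Gamma (1 - (β : ℂ) * s)) ∧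
        HasMellin (fun x : ℝ => mittagLeffler β 2 (-(x : ℂ))) s
          (Complex.Gamma s * Complex.Gamma (1 - s) / Complex.Gamma (2 - (β : ℂ) * s)))) ∧
    -- the Mittag-Leffler functions, order `β = 2`: the integrals converge conditionally
    ((∀ z : ℝ, 0 < z →
        (∀ c : ℝ, 0 < c → c < 1 / 4 →
          HasImproperBromwichIntegral c
            (fun s => Complex.Gamma s * Complex.Gamma (1 - s) / Complex.Gamma (1 - 2 * s)
              * (z : ℂ) ^ (-s))
            (mittagLeffler 2 1 (-(z : ℂ)))) ∧
        (∀ c : ℝ, 0 < c → c < 3 / 4 →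
          HasImproperBromwichIntegral c
            (fun s => Complex.Gamma s * Complex.Gamma (1 - s) / Complex.Gamma (2 - 2 * s)
              * (z : ℂ) ^ (-s))
            (mittagLeffler 2 2 (-(z : ℂ))))) ∧
      (∀ s : ℂ, 0 < s.re → s.re < 1 / 2 →
        HasImproperMellin (fun x : ℝ => mittagLeffler 2 1 (-(x : ℂ))) s
          (Complex.Gamma s * Complex.Gamma (1 - s) / Complex.Gamma (1 - 2 * s))) ∧
      (∀ s : ℂ, 0 < s.re → s.re < 1 →
        HasImproperMellin (fun x : ℝ => mittagLeffler 2 2 (-(x : ℂ))) s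
          (Complex.Gamma s * Complex.Gamma (1 - s) / Complex.Gamma (2 - 2 * s)))) ∧
    -- the Wright functions `M_γ` and `N_γ`
    (∀ γ : ℝ, 0 < γ → γ < 1 →
      (∀ c : ℝ, 0 < c → ∀ y : ℝ, 0 < y →
        HasBromwichIntegral c
          (fun s => Complex.Gamma s / Complex.Gamma (1 + (γ : ℂ) * (s - 1)) * (y : ℂ) ^ (-s))
          (wrightM γ (y : ℂ)) ∧
        HasBromwichIntegral c
          (fun s => Complex.Gamma s / Complex.Gamma (2 + (γ : ℂ) * (s - 1)) * (y : ℂ) ^ (-s))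
          (wrightN γ (y : ℂ))) ∧
      (∀ s : ℂ, 0 < s.re →
        HasMellin (fun y : ℝ => wrightM γ (y : ℂ)) s
          (Complex.Gamma s / Complex.Gamma (1 + (γ : ℂ) * (s - 1))) ∧
        HasMellin (fun y : ℝ => wrightN γ (y : ℂ)) s
          (Complex.Gamma s / Complex.Gamma (2 + (γ : ℂ) * (s - 1))))) := by
  refine ⟨fun β h0 h2 => ⟨fun c hc0 hc1 z hz => ⟨?_, ?_⟩, fun s hs0 hs1 => ⟨?_, ?_⟩⟩,
    ⟨fun z hz => ⟨fun c hc0 hc1 => ?_, fun c hc0 hc1 => ?_⟩, fun s hs0 hs1 => ?_,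
      fun s hs0 hs1 => ?_⟩,
    fun γ h0 h1 => ⟨fun c hc y hy => ⟨?_, ?_⟩, fun s hs => ⟨?_, ?_⟩⟩⟩
  · simpa using hasBromwichIntegral_mittagLeffler (b := 1) h0 h2 zero_le_one hc0 hc1 hz
  · simpa using hasBromwichIntegral_mittagLeffler (b := 2) h0 h2 zero_le_two hc0 hc1 hz
  · simpa using hasMellin_mittagLeffler (b := 1) h0 h2 zero_le_one hs0 hs1
  · simpa using hasMellin_mittagLeffler (b := 2) h0 h2 zero_le_two hs0 hs1
  · simpa using hasImproperBromwichIntegral_mittagLeffler_two (b := 1) zero_le_one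
      (by linarith) hc0 (by linarith) hz
  · simpa using hasImproperBromwichIntegral_mittagLeffler_two (b := 2) zero_le_two
      (by linarith) hc0 (by linarith) hz
  · exact (hasImproperMellin_cos_sqrt hs0 hs1).congr fun x hx => (mittagLeffler_two_one hx).symm
  · exact (hasImproperMellin_sin_sqrt_div_sqrt hs0 hs1).congr fun x hx =>
      (mittagLeffler_two_two hx).symm
  · simpa [wrightM] using hasBromwichIntegral_wright h0 h1 (Or.inl rfl) hc hy
  · simpa [wrightN] using hasBromwichIntegral_wright h0 h1 (Or.inr rfl) hc hy
  · simpa [wrightM] using hasMellin_wright h0 h1 (Or.inl rfl) hs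
  · simpa [wrightN] using hasMellin_wright h0 h1 (Or.inr rfl) hs
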